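/- Conventions. Modules are right modules unless a side is indicated; $\mathrm{mod}\,S$ is the category of finitely generated right $S$-modules. A Noetherian algebra is a ring that is finitely generated as a module over a commutative Noetherian ring (through a ring homomorphism into its centre). For a class $\mathcal U$ of objects of an abelian category, $\mathrm{add}\,\mathcal U$ is the class of direct summands of finite direct sums of objects of $\mathcal U$. Let $\mathscr A$ be an abelian category with enough projectives; $\Omega^n(A)$ denotes an $n$-th syzygy of $A$. The Igusa–Todorov distance $\mathrm{IT}(\mathscr A)\in\mathbb N\cup\{\infty\}$ is the infimum of all $m\ge 0$ for which there are $n\ge 0$ and an object $U$ such that for every object $A$ there is an exact sequence $0\to U_m\to\cdots\to U_0\to\Omega^n(A)\to 0$ with all $U_i\in\mathrm{add}\,U$. Put $[T]_1=\mathrm{add}\,T$ and let $[T]_{n}$ $(n\ge 2)$ be $\mathrm{add}$ of the class of all $A$ admitting a short exact sequence $0\to U\to A\to V\to 0$ with $U\in[T]_1$, $V\in[T]_{n-1}$; the extension dimension $\dim\mathscr A$ is the infimum of all $n\ge 0$ with $\mathscr A=[T]_{n+1}$ for some object $T$. In a triangulated category $\mathscr T$ let $\langle T\rangle_1$ be the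 closure of $T$ under shifts, finite direct sums and direct summands, and $\langle T\rangle_{n+1}$ the closure under the same operations of the class of all $X$ in a triangle $U\to X\to V\to U[1]$ with $U\in\langle T\rangle_1$, $V\in\langle T\rangle_n$; the Rouquier dimension $\mathrm{der.dim}\,\mathscr T$ is the infimum of all $n\ge 0$ with $\mathscr T=\langle T\rangle_{n+1}$ for some object $T$. (Infima of empty sets are $\infty$.) For a right Noetherian ring $S$ write $\mathrm{IT}(S)=\mathrm{IT}(\mathrm{mod}\,S)$ and $\dim S=\dim(\mathrm{mod}\,S)$. Theorem. Let $\Gamma$ be a Noetherian algebra, let $M$ be a $\Gamma$-bimodule that is finitely generated both as a left and as a right $\Gamma$-module, and let $\theta\colon M\otimes_\Gamma M\to M$ be a $\Gamma$-bimodule homomorphism with $\theta(\theta\otimes\mathrm{id}_M)=\theta(\mathrm{id}_M\otimes\theta)$. Let $n\ge 1$ be an integer with $M^{\otimes_\Gamma n}=0$. Let $\Gamma\ltimes_\theta M$ be the ring with underlying group $\Gamma\oplus M$ and multiplication $(\gamma,m)(\gamma',m')=(\gamma\gamma',\gamma m'+m\gamma'+\theta(m\otimes m'))$. 1. If ${}_\Gamma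 M$ and $M_\Gamma$ are projective, then $\mathrm{IT}(\Gamma)\le\mathrm{IT}(\Gamma\ltimes_\theta M)\le n(\mathrm{IT}(\Gamma)+1)-1$. 2. If $M_\Gamma$ is projective, then $\dim\Gamma\le\dim(\Gamma\ltimes_\theta M)\le n(\dim\Gamma+1)-1$. 3. If $M$ is left perfect, that is, the left $\Gamma$-module ${}_\Gamma M$ has finite projective dimension and $\mathrm{Tor}_i^\Gamma(M,M^{\otimes_\Gamma j})=0$ for all $i,j\ge 1$, then $$\mathrm{der.dim}\,\mathbf D^b(\mathrm{mod}\,\Gamma)\le\mathrm{der.dim}\,\mathbf D^b(\mathrm{mod}\,\Gamma\ltimes_\theta M)\le n\bigl(\mathrm{der.dim}\,\mathbf D^b(\mathrm{mod}\,\Gamma)+1\bigr)-1 .$$ -/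

import Mathlib

open CategoryTheory CategoryTheory.Limits MulOpposite
open scoped TensorProduct

universe v u

/-! ## Invariants of abelian and triangulated categories -/

section AbelianInvariants

variable {C : Type u} [Category.{v} C] [Abelian C]

attribute [local instance] Abelian.hasFiniteBiproducts

/-- `add U`: direct summands of finite direct sums of objects in `U`. -/
def addClosure (U : ObjectProperty C) : ObjectProperty C := fun X =>
  ∃ (k : ℕ) (Y : Fin k → C), (∀ i, U (Y i)) ∧ Nonempty (Retract X (⨁ Y))

/-- `IsSyzygy n X K`: the object `K` is an `n`-th syzygy `Ωⁿ(X)` of `X`, where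
`Ω⁰(X) = X` and `Ω¹(Y)` is the kernel of an epimorphism from a projective object onto `Y`. -/
def IsSyzygy : ℕ → C → C → Prop
  | 0, X, K => Nonempty (K ≅ X)
  | n + 1, X, K => ∃ Y : C, IsSyzygy n X Y ∧
      ∃ S : ShortComplex C, S.ShortExact ∧ Projective S.X₂ ∧
        Nonempty (S.X₁ ≅ K) ∧ Nonempty (S.X₃ ≅ Y)

/-- There is an exact sequence `0 → X m → ⋯ → X 1 → X 0 → K → 0` in which every `X i`
belongs to `V` (it is recorded as an infinite sequence with `X i = 0` for `i > m`). -/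
def HasResolution (V : ObjectProperty C) (m : ℕ) (K : C) : Prop :=
  ∃ (X : ℕ → C) (d : ∀ i, X (i + 1) ⟶ X i) (ε : X 0 ⟶ K)
    (w₀ : d 0 ≫ ε = 0) (w : ∀ i, d (i + 1) ≫ d i = 0),
    (∀ i ≤ m, V (X i)) ∧ (∀ i, m < i → IsZero (X i)) ∧
    Epi ε ∧ (ShortComplex.mk (d 0) ε w₀).Exact ∧
    ∀ i, (ShortComplex.mk (d (i + 1)) (d i) (w i)).Exact

variable (C)

/-- `(m, n)`-Igusa–Todorov categories. -/
def IsIgusaTodorovCategory (m n : ℕ) : Prop :=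
  ∃ U : C, ∀ A : C, ∃ K : C, IsSyzygy n A K ∧
    HasResolution (addClosure (ObjectProperty.singleton U)) m K

/-- The Igusa–Todorov distance (`⊤` if there is no `m`). -/
noncomputable def igusaTodorovDistance : ℕ∞ :=
  ⨅ (m : ℕ) (_ : ∃ n : ℕ, IsIgusaTodorovCategory C m n), (m : ℕ∞)

variable {C}

/-- `U ∙ V`: the additive closure of the class of all extensions `0 → U₁ → A → V₁ → 0`
with `U₁` in `U` and `V₁` in `V`. -/
def extensionBullet (U V : ObjectProperty C) : ObjectProperty C :=
  addClosure fun A => ∃ S : ShortComplex C, S.ShortExact ∧ U S.X₁ ∧ V S.X₃ ∧ S.X₂ = A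

/-- `[U]₀ = 0`, `[U]₁ = add U` and `[U]ₙ = [U]₁ ∙ [U]ₙ₋₁` for `n ≥ 2`. -/
def extensionLevel (U : ObjectProperty C) : ℕ → ObjectProperty C
  | 0 => fun X => IsZero X
  | 1 => addClosure U
  | n + 2 => extensionBullet (addClosure U) (extensionLevel U (n + 1))

variable (C)

/-- The extension dimension of an abelian category (`⊤` if there is no `n`). -/
noncomputable def extensionDimension : ℕ∞ :=
  ⨅ (n : ℕ) (_ : ∃ T : C, ∀ X : C, extensionLevel (ObjectProperty.singleton T) (n + 1) X),
    (n : ℕ∞)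

end AbelianInvariants

/-- The Rouquier dimension of a triangulated category (`⊤` if there is no `n`).
`triangEnvelopeIter n` is `⟨T⟩ₙ₊₁`: shifts, finite sums and summands of `T`, and `n` extensions. -/
noncomputable def rouquierDimension (T : Type u) [Category.{v} T] [HasZeroObject T]
    [HasShift T ℤ] [Preadditive T] [∀ n : ℤ, (shiftFunctor T n).Additive]
    [Pretriangulated T] : ℕ∞ :=
  ⨅ (n : ℕ) (_ : ∃ G : T, (ObjectProperty.singleton G).triangEnvelopeIter n = ⊤), (n : ℕ∞)

/-! ## Noetherian algebras and their categories of finitely generated right modules -/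

/-- A Noetherian algebra: a ring that is module-finite over a commutative Noetherian ring. -/
class IsNoetherianAlgebra (Γ : Type u) [Ring Γ] : Prop where
  out : ∃ (R : Type u) (_ : CommRing R) (_ : Algebra R Γ), IsNoetherianRing R ∧ Module.Finite R Γ

instance IsNoetherianAlgebra.isNoetherianRing_op (Γ : Type u) [Ring Γ] [h : IsNoetherianAlgebra Γ] :
    IsNoetherianRing Γᵐᵒᵖ := by
  obtain ⟨R, _, _, _, _⟩ := h.out
  have : Module.Finite R Γᵐᵒᵖ := Module.Finite.equiv (opLinearEquiv R : Γ ≃ₗ[R] Γᵐᵒᵖ)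
  have : IsNoetherian R Γᵐᵒᵖ := inferInstance
  exact isNoetherian_of_tower R this

section RingInvariants

variable (Γ : Type u) [Ring Γ]

/-- `mod-Γ`: finitely generated right `Γ`-modules, i.e. left modules over `Γᵐᵒᵖ`. -/
abbrev FGRightMod : Type (u + 1) := FGModuleCat.{u} Γᵐᵒᵖ

variable [IsNoetherianRing Γᵐᵒᵖ]

/-- `IT(Γ)`, the Igusa–Todorov distance of `mod-Γ`. -/
noncomputable def ringIT : ℕ∞ := igusaTodorovDistance (FGRightMod Γ)

/-- `dim Γ`, the extension dimension of `mod-Γ`. -/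
noncomputable def ringExtDim : ℕ∞ := extensionDimension (FGRightMod Γ)

/-- The Rouquier dimension of the bounded derived category of `mod-Γ`. -/
noncomputable def ringDerDim : ℕ∞ :=
  letI := HasDerivedCategory.standard (FGRightMod Γ)
  rouquierDimension (DerivedCategory.Bounded (FGRightMod Γ))

end RingInvariants

/-! ## Tensor products over a noncommutative ring -/

section BalancedTensor

variable (Γ : Type u) [Ring Γ]

/-- The relations `mγ ⊗ n = m ⊗ γn`. -/
def balancedRelations (M N : Type u) [AddCommGroup M] [Module Γᵐᵒᵖ M]
    [AddCommGroup N] [Module Γ N] : AddSubgroup (M ⊗[ℤ] N) :=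
  AddSubgroup.closure {x | ∃ (m : M) (γ : Γ) (n : N), x = (op γ • m) ⊗ₜ[ℤ] n - m ⊗ₜ[ℤ] (γ • n)}

/-- `M ⊗_Γ N` for a right `Γ`-module `M` and a left `Γ`-module `N`. -/
def BalancedTensor (M N : Type u) [AddCommGroup M] [Module Γᵐᵒᵖ M]
    [AddCommGroup N] [Module Γ N] : Type u :=
  (M ⊗[ℤ] N) ⧸ balancedRelations Γ M N

namespace BalancedTensor

section Basic

variable {M N : Type u} [AddCommGroup M] [Module Γᵐᵒᵖ M] [AddCommGroup N] [Module Γ N]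

instance : AddCommGroup (BalancedTensor Γ M N) :=
  inferInstanceAs (AddCommGroup ((M ⊗[ℤ] N) ⧸ balancedRelations Γ M N))

/-- The pure tensor `m ⊗ n`. -/
def tmul (m : M) (n : N) : BalancedTensor Γ M N := QuotientAddGroup.mk' (balancedRelations Γ M N) (m ⊗ₜ[ℤ] n)

lemma add_tmul (m m' : M) (n : N) : tmul Γ (m + m') n = tmul Γ m n + tmul Γ m' n := by
  simp only [tmul, TensorProduct.add_tmul, map_add]; rfl

lemma tmul_add (m : M) (n n' : N) : tmul Γ m (n + n') = tmul Γ m n + tmul Γ m n' := by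
  simp only [tmul, TensorProduct.tmul_add, map_add]; rfl

lemma zero_tmul (n : N) : tmul Γ (0 : M) n = 0 := by
  simp only [tmul, TensorProduct.zero_tmul, map_zero]; rfl

lemma tmul_zero (m : M) : tmul Γ m (0 : N) = 0 := by
  simp only [tmul, TensorProduct.tmul_zero, map_zero]; rfl

lemma smul_tmul (m : M) (γ : Γ) (n : N) : tmul Γ (op γ • m) n = tmul Γ m (γ • n) := by
  refine QuotientAddGroup.eq_iff_sub_mem.mpr (AddSubgroup.subset_closure ⟨m, γ, n, rfl⟩)

variable {Γ} in
@[elab_as_elim]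
lemma induction_on {p : BalancedTensor Γ M N → Prop} (x : BalancedTensor Γ M N)
    (zero : p 0) (tmul : ∀ m n, p (tmul Γ m n)) (add : ∀ x y, p x → p y → p (x + y)) : p x := by
  obtain ⟨t, rfl⟩ := QuotientAddGroup.mk'_surjective (balancedRelations Γ M N) x
  induction t using TensorProduct.induction_on with
  | zero => rw [map_zero]; exact zero
  | tmul m n => exact tmul m n
  | add a b ha hb => rw [map_add]; exact add _ _ ha hb

variable {M' N' : Type u} [AddCommGroup M'] [Module Γᵐᵒᵖ M'] [AddCommGroup N'] [Module Γ N']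

/-- `f ⊗ g` for a right-linear map `f` and a left-linear map `g`. -/
def map (f : M →ₗ[Γᵐᵒᵖ] M') (g : N →ₗ[Γ] N') : BalancedTensor Γ M N →+ BalancedTensor Γ M' N' :=
  QuotientAddGroup.map (balancedRelations Γ M N) (balancedRelations Γ M' N')
    (TensorProduct.map f.toAddMonoidHom.toIntLinearMap
      g.toAddMonoidHom.toIntLinearMap).toAddMonoidHom (by
      rw [balancedRelations, AddSubgroup.closure_le]
      rintro _ ⟨m, γ, n, rfl⟩
      refine AddSubgroup.subset_closure ⟨f m, γ, g n, ?_⟩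
      rw [map_sub]
      exact congrArg₂ (fun a b => a ⊗ₜ[ℤ] g n - f m ⊗ₜ[ℤ] b) (f.map_smul _ _) (g.map_smul _ _))

@[simp]
lemma map_tmul (f : M →ₗ[Γᵐᵒᵖ] M') (g : N →ₗ[Γ] N') (m : M) (n : N) :
    map Γ f g (tmul Γ m n) = tmul Γ (f m) (g n) := rfl

end Basic

section LeftModule

variable {M N : Type u} [AddCommGroup M] [Module Γ M] [Module Γᵐᵒᵖ M] [SMulCommClass Γ Γᵐᵒᵖ M]
  [AddCommGroup N] [Module Γ N]

/-- The left action `γ(m ⊗ n) = γm ⊗ n`. -/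
instance : SMul Γ (BalancedTensor Γ M N) where
  smul γ := map Γ (Module.toModuleEnd Γᵐᵒᵖ (S := Γ) M γ) LinearMap.id

lemma smul_tmul_left (γ : Γ) (m : M) (n : N) : γ • tmul Γ m n = tmul Γ (γ • m) n := rfl

instance : DistribSMul Γ (BalancedTensor Γ M N) where
  smul_zero γ := map_zero (map Γ (Module.toModuleEnd Γᵐᵒᵖ (S := Γ) M γ) LinearMap.id)
  smul_add γ := map_add (map Γ (Module.toModuleEnd Γᵐᵒᵖ (S := Γ) M γ) LinearMap.id)

instance : Module Γ (BalancedTensor Γ M N) where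
  smul_zero := smul_zero
  smul_add := smul_add
  one_smul x := by
    induction x using induction_on with
    | zero => exact smul_zero _
    | tmul m n => rw [smul_tmul_left, one_smul]
    | add x y hx hy => rw [smul_add, hx, hy]
  mul_smul a b x := by
    induction x using induction_on with
    | zero => simp only [smul_zero]
    | tmul m n => simp only [smul_tmul_left, mul_smul]
    | add x y hx hy => simp only [smul_add, hx, hy]
  add_smul a b x := by
    induction x using induction_on with
    | zero => simp only [smul_zero, add_zero]
    | tmul m n => simp only [smul_tmul_left, add_smul, add_tmul]
    | add x y hx hy => simp only [smul_add, hx, hy]; abel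
  zero_smul x := by
    induction x using induction_on with
    | zero => exact smul_zero _
    | tmul m n => rw [smul_tmul_left, zero_smul, zero_tmul]
    | add x y hx hy => rw [smul_add, hx, hy, add_zero]

end LeftModule

section RightModule

variable {M N : Type u} [AddCommGroup M] [Module Γᵐᵒᵖ M]
  [AddCommGroup N] [Module Γ N] [Module Γᵐᵒᵖ N] [SMulCommClass Γ Γᵐᵒᵖ N]

/-- The right action `(m ⊗ n)γ = m ⊗ nγ`. -/
instance : SMul Γᵐᵒᵖ (BalancedTensor Γ M N) where
  smul γ :=
    haveI := SMulCommClass.symm Γ Γᵐᵒᵖ N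
    map Γ LinearMap.id (Module.toModuleEnd Γ (S := Γᵐᵒᵖ) N γ)

lemma smul_tmul_right (γ : Γᵐᵒᵖ) (m : M) (n : N) : γ • tmul Γ m n = tmul Γ m (γ • n) := rfl

instance : DistribSMul Γᵐᵒᵖ (BalancedTensor Γ M N) where
  smul_zero γ :=
    haveI := SMulCommClass.symm Γ Γᵐᵒᵖ N
    map_zero (map Γ (LinearMap.id (M := M)) (Module.toModuleEnd Γ (S := Γᵐᵒᵖ) N γ))
  smul_add γ :=
    haveI := SMulCommClass.symm Γ Γᵐᵒᵖ N
    map_add (map Γ (LinearMap.id (M := M)) (Module.toModuleEnd Γ (S := Γᵐᵒᵖ) N γ))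

instance : Module Γᵐᵒᵖ (BalancedTensor Γ M N) where
  smul_zero := smul_zero
  smul_add := smul_add
  one_smul x := by
    induction x using induction_on with
    | zero => exact smul_zero _
    | tmul m n => rw [smul_tmul_right, one_smul]
    | add x y hx hy => rw [smul_add, hx, hy]
  mul_smul a b x := by
    induction x using induction_on with
    | zero => simp only [smul_zero]
    | tmul m n => simp only [smul_tmul_right, mul_smul]
    | add x y hx hy => simp only [smul_add, hx, hy]
  add_smul a b x := by
    induction x using induction_on with
    | zero => simp only [smul_zero, add_zero]
    | tmul m n => simp only [smul_tmul_right, add_smul, tmul_add]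
    | add x y hx hy => simp only [smul_add, hx, hy]; abel
  zero_smul x := by
    induction x using induction_on with
    | zero => exact smul_zero _
    | tmul m n => rw [smul_tmul_right, zero_smul, tmul_zero]
    | add x y hx hy => rw [smul_add, hx, hy, add_zero]

end RightModule

instance {M N : Type u} [AddCommGroup M] [Module Γ M] [Module Γᵐᵒᵖ M] [SMulCommClass Γ Γᵐᵒᵖ M]
    [AddCommGroup N] [Module Γ N] [Module Γᵐᵒᵖ N] [SMulCommClass Γ Γᵐᵒᵖ N] :
    SMulCommClass Γ Γᵐᵒᵖ (BalancedTensor Γ M N) where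
  smul_comm a b x := by
    induction x using induction_on with
    | zero => simp only [smul_zero]
    | tmul m n => simp only [smul_tmul_right, smul_tmul_left]
    | add x y hx hy => simp only [smul_add, hx, hy]

end BalancedTensor

/-- A bundled `Γ`-bimodule. -/
structure BimoduleObj : Type (u + 1) where
  carrier : Type u
  [addCommGroup : AddCommGroup carrier]
  [left : Module Γ carrier]
  [right : Module Γᵐᵒᵖ carrier]
  [comm : SMulCommClass Γ Γᵐᵒᵖ carrier]

attribute [instance] BimoduleObj.addCommGroup BimoduleObj.left BimoduleObj.right BimoduleObj.comm

section Powers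

variable (M : Type u) [AddCommGroup M] [Module Γ M] [Module Γᵐᵒᵖ M] [SMulCommClass Γ Γᵐᵒᵖ M]

/-- The bimodule `M^{⊗ n}`: `Γ`, `M`, `M ⊗_Γ M`, `M ⊗_Γ (M ⊗_Γ M)`, … -/
def tensorPowerObj : ℕ → BimoduleObj Γ
  | 0 => ⟨Γ⟩
  | 1 => ⟨M⟩
  | n + 2 => ⟨BalancedTensor Γ M (tensorPowerObj (n + 1)).carrier⟩

/-- The underlying group of `M^{⊗ n}`. -/
abbrev BimodulePower (n : ℕ) : Type u := (tensorPowerObj Γ M n).carrier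

end Powers

/-! ### Tor and left perfect bimodules -/

section Tor

variable (M : Type u) [AddCommGroup M] [Module Γᵐᵒᵖ M]

/-- The functor `M ⊗_Γ -` from left `Γ`-modules to abelian groups. -/
def balancedTensorFunctor : ModuleCat.{u} Γ ⥤ AddCommGrpCat.{u} where
  obj N := AddCommGrpCat.of (BalancedTensor Γ M N)
  map f := AddCommGrpCat.ofHom (BalancedTensor.map Γ LinearMap.id f.hom)
  map_id N := by
    ext x
    induction x using BalancedTensor.induction_on with
    | zero => simp
    | tmul m n => rfl
    | add x y hx hy => simp only [map_add, hx, hy]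
  map_comp f g := by
    ext x
    induction x using BalancedTensor.induction_on with
    | zero => simp
    | tmul m n => rfl
    | add x y hx hy => simp only [map_add, hx, hy]

instance : (balancedTensorFunctor Γ M).Additive where
  map_add {N N' f g} := by
    ext x
    change BalancedTensor.map Γ LinearMap.id (f + g).hom x =
      BalancedTensor.map Γ LinearMap.id f.hom x + BalancedTensor.map Γ LinearMap.id g.hom x
    induction x using BalancedTensor.induction_on with
    | zero => simp
    | tmul m n => exact BalancedTensor.tmul_add Γ m (f.hom n) (g.hom n)
    | add x y hx hy => simp only [map_add, hx, hy]; abel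

/-- `Tor_i^Γ(M, N)` for a right module `M` and a left module `N`. -/
noncomputable def balancedTor (i : ℕ) (N : Type u) [AddCommGroup N] [Module Γ N] :
    AddCommGrpCat.{u} :=
  ((balancedTensorFunctor Γ M).leftDerived i).obj (ModuleCat.of Γ N)

end Tor

/-- A bimodule `M` is left perfect if `pd (_Γ M) < ∞` and `Tor_i^Γ(M, M^{⊗ j}) = 0` for all
`i, j ≥ 1`. -/
structure IsLeftPerfect (M : Type u) [AddCommGroup M] [Module Γ M] [Module Γᵐᵒᵖ M]
    [SMulCommClass Γ Γᵐᵒᵖ M] : Prop where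
  projectiveDimension_lt_top : ∃ d : ℕ, HasProjectiveDimensionLE (ModuleCat.of Γ M) d
  tor_eq_zero : ∀ i j : ℕ, 1 ≤ i → 1 ≤ j → IsZero (balancedTor Γ M i (BimodulePower Γ M j))

end BalancedTensor

/-! ## The `θ`-extension ring -/

/-- An associative `Γ`-bimodule homomorphism `θ : M ⊗_Γ M → M`. -/
structure AssocBimoduleHom (Γ : Type u) [Ring Γ] (M : Type u) [AddCommGroup M] [Module Γ M]
    [Module Γᵐᵒᵖ M] [SMulCommClass Γ Γᵐᵒᵖ M] where
  toHom : BalancedTensor Γ M M →+ M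
  map_smul_left : ∀ (γ : Γ) (x : BalancedTensor Γ M M), toHom (γ • x) = γ • toHom x
  map_smul_right : ∀ (γ : Γᵐᵒᵖ) (x : BalancedTensor Γ M M), toHom (γ • x) = γ • toHom x
  assoc : ∀ m m' m'' : M,
    toHom (BalancedTensor.tmul Γ (toHom (BalancedTensor.tmul Γ m m')) m'') =
      toHom (BalancedTensor.tmul Γ m (toHom (BalancedTensor.tmul Γ m' m'')))

section ThetaExtension

variable {Γ : Type u} [Ring Γ] {M : Type u} [AddCommGroup M] [Module Γ M]
  [Module Γᵐᵒᵖ M] [SMulCommClass Γ Γᵐᵒᵖ M]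

/-- The `θ`-extension `Γ ⋉_θ M`, with underlying group `Γ ⊕ M`. -/
def ThetaExtension (_θ : AssocBimoduleHom Γ M) : Type u := Γ × M

namespace ThetaExtension

variable {θ : AssocBimoduleHom Γ M}

instance : AddCommGroup (ThetaExtension θ) := inferInstanceAs (AddCommGroup (Γ × M))

/-- `(γ, m)(γ', m') = (γγ', γm' + mγ' + θ(m ⊗ m'))`. -/
instance : Mul (ThetaExtension θ) where
  mul x y := (x.1 * y.1, x.1 • y.2 + op y.1 • x.2 + θ.toHom (BalancedTensor.tmul Γ x.2 y.2))

instance : One (ThetaExtension θ) where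
  one := ((1 : Γ), (0 : M))

@[ext]
lemma ext {x y : ThetaExtension θ} (h₁ : x.1 = y.1) (h₂ : x.2 = y.2) : x = y := Prod.ext h₁ h₂

@[simp] lemma fst_add (x y : ThetaExtension θ) : (x + y).1 = x.1 + y.1 := rfl
@[simp] lemma snd_add (x y : ThetaExtension θ) : (x + y).2 = x.2 + y.2 := rfl
@[simp] lemma fst_zero : (0 : ThetaExtension θ).1 = 0 := rfl
@[simp] lemma snd_zero : (0 : ThetaExtension θ).2 = 0 := rfl
@[simp] lemma fst_one : (1 : ThetaExtension θ).1 = 1 := rfl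
@[simp] lemma snd_one : (1 : ThetaExtension θ).2 = 0 := rfl
@[simp] lemma fst_mul (x y : ThetaExtension θ) : (x * y).1 = x.1 * y.1 := rfl
@[simp] lemma snd_mul (x y : ThetaExtension θ) : (x * y).2 =
    x.1 • y.2 + op y.1 • x.2 + θ.toHom (BalancedTensor.tmul Γ x.2 y.2) := rfl

instance : Ring (ThetaExtension θ) where
  __ := (inferInstance : AddCommGroup (ThetaExtension θ))
  mul_assoc x y z := by
    ext
    · simp [mul_assoc]
    · simp only [snd_mul, fst_mul, smul_add, BalancedTensor.add_tmul, BalancedTensor.tmul_add,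
        map_add, θ.assoc, ← BalancedTensor.smul_tmul_left, ← BalancedTensor.smul_tmul_right,
        BalancedTensor.smul_tmul, θ.map_smul_left, θ.map_smul_right, mul_smul, op_mul,
        smul_comm x.1 (op z.1) y.2]
      abel
  one_mul x := by ext <;> simp [BalancedTensor.zero_tmul]
  mul_one x := by ext <;> simp [BalancedTensor.tmul_zero]
  zero_mul x := by ext <;> simp [BalancedTensor.zero_tmul]
  mul_zero x := by ext <;> simp [BalancedTensor.tmul_zero]
  left_distrib x y z := by
    ext
    · simp [mul_add]
    · simp only [snd_mul, snd_add, fst_add, smul_add, BalancedTensor.tmul_add, map_add, MulOpposite.op_add,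
        add_smul]
      abel
  right_distrib x y z := by
    ext
    · simp [add_mul]
    · simp only [snd_mul, snd_add, fst_add, smul_add, BalancedTensor.add_tmul, map_add, add_smul]
      abel

/-- The ring homomorphism `γ ↦ (γ, 0)`. -/
def inl (θ : AssocBimoduleHom Γ M) : Γ →+* ThetaExtension θ where
  toFun γ := ((γ, 0) : Γ × M)
  map_one' := rfl
  map_zero' := rfl
  map_mul' a b := by
    refine ThetaExtension.ext rfl ?_
    change (0 : M) = a • (0 : M) + op b • (0 : M) + θ.toHom (BalancedTensor.tmul Γ (0 : M) (0 : M))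
    simp [BalancedTensor.zero_tmul]
  map_add' a b := ThetaExtension.ext rfl (add_zero (0 : M)).symm

/-- If `Γ` is right Noetherian and `M` is finitely generated on the right, then `Γ ⋉_θ M` is
right Noetherian. -/
instance isNoetherianRing_op [IsNoetherianRing Γᵐᵒᵖ] [Module.Finite Γᵐᵒᵖ M] :
    IsNoetherianRing (ThetaExtension θ)ᵐᵒᵖ := by
  let : Module Γᵐᵒᵖ (ThetaExtension θ)ᵐᵒᵖ := Module.compHom _ (inl θ).op
  have hs : ∀ (γ : Γᵐᵒᵖ) (x : (ThetaExtension θ)ᵐᵒᵖ), γ • x = op (inl θ γ.unop) * x :=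
    fun _ _ => rfl
  have : IsScalarTower Γᵐᵒᵖ (ThetaExtension θ)ᵐᵒᵖ (ThetaExtension θ)ᵐᵒᵖ :=
    ⟨fun γ x y => by simp only [hs, smul_eq_mul, mul_assoc]⟩
  let e : (Γᵐᵒᵖ × M) →ₗ[Γᵐᵒᵖ] (ThetaExtension θ)ᵐᵒᵖ :=
    { toFun := fun p => op ((p.1.unop, p.2) : Γ × M)
      map_add' := fun _ _ => rfl
      map_smul' := fun γ p => by
        apply unop_injective
        rw [RingHom.id_apply, hs]
        refine ThetaExtension.ext rfl ?_
        change γ • p.2 = p.1.unop • (0 : M) + op γ.unop • p.2 +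
          θ.toHom (BalancedTensor.tmul Γ p.2 (0 : M))
        simp [BalancedTensor.tmul_zero] }
  have he : Function.Surjective e := fun x => ⟨(op x.unop.1, x.unop.2), rfl⟩
  have : IsNoetherian Γᵐᵒᵖ (ThetaExtension θ)ᵐᵒᵖ :=
    isNoetherian_of_surjective (f := e) (LinearMap.range_eq_top.mpr he)
  exact isNoetherian_of_tower Γᵐᵒᵖ this

end ThetaExtension

end ThetaExtension

/-!
Write `Λ = Γ ⋉_θ M`. The ring `Γ` is a retract of `Λ`, so restriction along `Γ → Λ` is an exact
and essentially surjective functor `mod Λ ⥤ mod Γ`, which preserves projectives if `M_Γ` is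
projective. Pushing generators along it gives the lower bounds.

Since `M^{⊗n} = 0`, every `Λ`-module `X` has a functorial filtration `X ⊇ XM ⊇ (XM)M ⊇ ⋯` of
length `n`, with layers inflated from `Γ`. Assembling `n` modules of `mod Γ` along the filtration
gives the upper bound for the extension dimension. Applied in each degree of a bounded complex, the
same filtration gives the one for the bounded derived category.

For the Igusa–Todorov distance the modules induced from `Γ` take the place of the inflated ones,
because induction preserves projectives, hence syzygies. The kernel of the counit `X ⊗_Γ Λ → X` is
a quotient of `X ⊗_Γ M` as a `Γ`-module, so iterating this kernel `n` times gives zero, and `X` has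
a resolution by `n` induced modules. Syzygies of these have resolutions with `m + 1` terms, which
the horseshoe lemma splices into resolutions with `n (m + 1)` terms.
-/

section Extensions

universe v' u'

variable {C : Type u} [Category.{v} C] [Abelian C] {D : Type u'} [Category.{v'} D] [Abelian D]

attribute [local instance] Abelian.hasFiniteBiproducts

/-- `IsExtension A B Q`: the object `B` is an extension of `Q` by `A`, that is, there is a short
exact sequence `0 → A → B → Q → 0`. -/
def IsExtension (A B Q : C) : Prop :=
  ∃ (f : A ⟶ B) (g : B ⟶ Q) (w : f ≫ g = 0), (ShortComplex.mk f g w).ShortExact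

lemma shortExact_pullback {A B Q Q' : C} {f : A ⟶ B} {g : B ⟶ Q} {w : f ≫ g = 0}
    (h : (ShortComplex.mk f g w).ShortExact) (k : Q' ⟶ Q) :
    (ShortComplex.mk (pullback.lift (f := g) (g := k) f 0 (by rw [w, zero_comp]))
      (pullback.snd g k) (pullback.lift_snd _ _ _)).ShortExact := by
  have : Mono f := h.mono_f
  have : Epi g := h.epi_g
  have hmono : Mono (pullback.lift (f := g) (g := k) f 0 (by rw [w, zero_comp])) :=
    mono_of_mono_fac (pullback.lift_fst _ _ _)
  refine ShortComplex.ShortExact.mk' (ShortComplex.exact_of_f_is_kernel _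
    (KernelFork.IsLimit.ofι' _ _ fun {T} x hx => ?_)) hmono inferInstance
  have hx' : (x ≫ pullback.fst g k) ≫ g = 0 := by
    rw [Category.assoc, pullback.condition, reassoc_of% hx, zero_comp]
  refine ⟨h.exact.lift _ hx', pullback.hom_ext ?_ ?_⟩
  · rw [Category.assoc, pullback.lift_fst]
    exact h.exact.lift_f _ hx'
  · rw [Category.assoc, pullback.lift_snd, comp_zero]
    exact hx.symm

lemma shortExact_pullback_fst_comp {A B Q V : C} {f : A ⟶ B} {g : B ⟶ Q} {w : f ≫ g = 0}
    (h : (ShortComplex.mk f g w).ShortExact) (p : V ⟶ B) [Epi p] :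
    (ShortComplex.mk (pullback.fst p f) (p ≫ g)
      (by rw [pullback.condition_assoc, w, comp_zero])).ShortExact := by
  have : Mono f := h.mono_f
  have : Epi g := h.epi_g
  refine ShortComplex.ShortExact.mk' (ShortComplex.exact_of_f_is_kernel _
    (KernelFork.IsLimit.ofι' _ _ fun {T} x hx => ?_)) inferInstance (epi_comp p g)
  exact ⟨pullback.lift x (h.exact.lift (x ≫ p) (by simpa using hx))
    (h.exact.lift_f (x ≫ p) _).symm, pullback.lift_fst _ _ _⟩

namespace IsExtension

lemma of_shortExact {S : ShortComplex C} (h : S.ShortExact) : IsExtension S.X₁ S.X₂ S.X₃ :=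
  ⟨S.f, S.g, S.zero, h⟩

lemma of_iso {A B Q A' B' Q' : C} (h : IsExtension A B Q) (a : A ≅ A') (b : B ≅ B')
    (q : Q ≅ Q') : IsExtension A' B' Q' := by
  obtain ⟨f, g, w, h⟩ := h
  refine ⟨a.inv ≫ f ≫ b.hom, b.inv ≫ g ≫ q.hom, by simp [reassoc_of% w], ?_⟩
  exact ShortComplex.shortExact_of_iso
    (ShortComplex.isoMk (S₁ := ShortComplex.mk f g w) a b q (by simp) (by simp)) h

lemma of_isZero {A B Q : C} (hA : IsZero A) (hB : IsZero B) (hQ : IsZero Q) :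
    IsExtension A B Q :=
  ⟨0, 0, zero_comp, ShortComplex.ShortExact.mk' (ShortComplex.exact_of_isZero_X₂ _ hB)
    ⟨fun _ _ _ => hA.eq_of_tgt _ _⟩ ⟨fun _ _ _ => hQ.eq_of_src _ _⟩⟩

lemma nonempty_iso_of_isZero_left {A B Q : C} (h : IsExtension A B Q) (hA : IsZero A) :
    Nonempty (B ≅ Q) := by
  obtain ⟨f, g, w, h⟩ := h
  have := h.isIso_g_iff.mpr hA
  exact ⟨asIso g⟩

lemma nonempty_iso_of_isZero_right {A B Q : C} (h : IsExtension A B Q) (hQ : IsZero Q) :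
    Nonempty (A ≅ B) := by
  obtain ⟨f, g, w, h⟩ := h
  have := h.isIso_f_iff.mpr hQ
  exact ⟨asIso f⟩

protected lemma kernel {B Q : C} (g : B ⟶ Q) [Epi g] : IsExtension (kernel g) B Q :=
  ⟨kernel.ι g, g, kernel.condition g,
    ShortComplex.ShortExact.mk' (ShortComplex.exact_of_f_is_kernel _ (kernelIsKernel g))
      inferInstance inferInstance⟩

protected lemma op {A B Q : C} (h : IsExtension A B Q) :
    IsExtension (Opposite.op Q) (Opposite.op B) (Opposite.op A) := by
  obtain ⟨f, g, w, h⟩ := h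
  exact ⟨g.op, f.op, by rw [← op_comp, w, Limits.op_zero], h.op⟩

protected lemma unop {A B Q : Cᵒᵖ} (h : IsExtension A B Q) :
    IsExtension Q.unop B.unop A.unop := by
  obtain ⟨f, g, w, h⟩ := h
  exact ⟨g.unop, f.unop, by rw [← unop_comp, w, Limits.unop_zero], h.unop⟩

protected lemma map {A B Q : C} (h : IsExtension A B Q) (F : C ⥤ D) [F.Additive]
    [PreservesFiniteLimits F] [PreservesFiniteColimits F] :
    IsExtension (F.obj A) (F.obj B) (F.obj Q) := by
  obtain ⟨f, g, w, h⟩ := h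
  exact ⟨F.map f, F.map g, by rw [← F.map_comp, w, F.map_zero], h.map_of_exact F⟩

lemma exists_kernel {K V A A' Q : C} (h : IsExtension K V A) (h' : IsExtension A' A Q) :
    ∃ N, IsExtension N V Q ∧ IsExtension K N A' := by
  obtain ⟨i, p, w, h⟩ := h
  obtain ⟨f, g, w', h'⟩ := h'
  have : Epi p := h.epi_g
  exact ⟨pullback p f, ⟨_, _, _, shortExact_pullback_fst_comp h' p⟩,
    ⟨_, _, _, shortExact_pullback h f⟩⟩

lemma exists_quotient {U A V B Q : C} (h : IsExtension U A V) (h' : IsExtension A B Q) :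
    ∃ X, IsExtension U B X ∧ IsExtension V X Q := by
  obtain ⟨X, h₁, h₂⟩ := h'.op.exists_kernel h.op
  exact ⟨X.unop, h₁.unop, h₂.unop⟩

lemma exists_retract_right {A B Q Q' : C} (h : IsExtension A B Q) (r : Retract Q Q') :
    ∃ B', IsExtension A B' Q' ∧ Nonempty (Retract B B') := by
  obtain ⟨f, g, w, h⟩ := h
  exact ⟨pullback g r.r, ⟨_, _, _, shortExact_pullback h r.r⟩,
    ⟨⟨pullback.lift (𝟙 B) (g ≫ r.i) (by simp), pullback.fst _ _, pullback.lift_fst _ _ _⟩⟩⟩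

lemma exists_retract_left {A B Q A' : C} (h : IsExtension A B Q) (r : Retract A A') :
    ∃ B', IsExtension A' B' Q ∧ Nonempty (Retract B B') := by
  obtain ⟨B', h', ⟨s⟩⟩ := h.op.exists_retract_right
    (Q' := Opposite.op A') ⟨r.r.op, r.i.op, by rw [← op_comp, r.retract, op_id]⟩
  exact ⟨B'.unop, h'.unop, ⟨⟨s.r.unop, s.i.unop, by rw [← unop_comp, s.retract, unop_id]⟩⟩⟩

protected lemma biproduct {ι : Type} [Finite ι] {A B Q : ι → C}
    (h : ∀ i, IsExtension (A i) (B i) (Q i)) : IsExtension (⨁ A) (⨁ B) (⨁ Q) := by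
  choose f g w h using h
  have (i : ι) : Mono (f i) := (h i).mono_f
  have (i : ι) : Epi (g i) := (h i).epi_g
  refine ⟨biproduct.map f, biproduct.map g, by ext; simp [w], ?_⟩
  refine ShortComplex.ShortExact.mk' (ShortComplex.exact_of_f_is_kernel _
    (KernelFork.IsLimit.ofι' _ _ fun {T} x hx => ?_))
    (biproduct.map_mono f) (biproduct.map_epi g)
  have hx' (i : ι) : (x ≫ biproduct.π B i) ≫ g i = 0 := by simpa using hx =≫ biproduct.π _ i
  refine ⟨biproduct.lift fun i => (h i).exact.lift _ (hx' i), ?_⟩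
  ext i
  simpa using (h i).exact.lift_f _ (hx' i)

lemma biprod_right {A B Q : C} (h : IsExtension A B Q) (P : C) :
    IsExtension A (B ⊞ P) (Q ⊞ P) := by
  obtain ⟨f, g, w, h⟩ := h
  have : Mono f := h.mono_f
  have : Epi g := h.epi_g
  refine ⟨f ≫ biprod.inl, biprod.map g (𝟙 P), by simp [reassoc_of% w], ?_⟩
  refine ShortComplex.ShortExact.mk' (ShortComplex.exact_of_f_is_kernel _
    (KernelFork.IsLimit.ofι' _ _ fun {T} x hx => ?_)) (mono_comp _ _) (biprod.map_epi g (𝟙 P))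
  have hx₁ : (x ≫ biprod.fst) ≫ g = 0 := by simpa using hx =≫ biprod.fst
  have hx₂ : x ≫ biprod.snd = 0 := by simpa using hx =≫ biprod.snd
  refine ⟨h.exact.lift _ hx₁, ?_⟩
  ext
  · simpa using h.exact.lift_f _ hx₁
  · simpa using hx₂.symm

lemma nonempty_iso_biprod {A B P : C} [Projective P] (h : IsExtension A B P) :
    Nonempty (B ≅ A ⊞ P) := by
  obtain ⟨f, g, w, h⟩ := h
  exact ⟨(h.splittingOfProjective).isoBinaryBiproduct⟩

lemma rotate {K L Q O P : C} [Projective P] (h : IsExtension K L Q) (h' : IsExtension O P Q) :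
    IsExtension O (K ⊞ P) L := by
  obtain ⟨f, g, w, h⟩ := h
  obtain ⟨f', g', w', h'⟩ := h'
  obtain ⟨e⟩ := nonempty_iso_biprod ⟨_, _, _, shortExact_pullback h g'⟩
  have hL : IsExtension O (pullback g' g) L := ⟨_, _, _, shortExact_pullback h' g⟩
  exact hL.of_iso (Iso.refl _) (pullbackSymmetry g' g ≪≫ e) (Iso.refl _)

lemma horseshoe {K V A B Q L P : C} [Projective P] (h₁ : IsExtension K V A)
    (h₂ : IsExtension A B Q) (h₃ : IsExtension L P Q) :
    ∃ N, IsExtension N (V ⊞ P) B ∧ IsExtension K N L :=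
  (h₁.biprod_right P).exists_kernel (h₂.rotate h₃)

end IsExtension

end Extensions

section AddClosure

universe v' u'

variable {C : Type u} [Category.{v} C] [Abelian C] {D : Type u'} [Category.{v'} D] [Abelian D]

attribute [local instance] Abelian.hasFiniteBiproducts

lemma addClosure_of_finite {U : ObjectProperty C} {ι : Type} [Finite ι] {X : C} (Y : ι → C)
    (hY : ∀ i, U (Y i)) (r : Retract X (⨁ Y)) : addClosure U X := by
  obtain ⟨k, ⟨e⟩⟩ := Finite.exists_equiv_fin ι
  refine ⟨k, Y ∘ e.symm, fun i => hY _, ⟨r.trans (Retract.ofIso ?_)⟩⟩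
  exact biproduct.whiskerEquiv e (fun j => eqToIso (by simp))

lemma le_addClosure (U : ObjectProperty C) : U ≤ addClosure U := fun X hX =>
  addClosure_of_finite (ι := Unit) (fun _ => X) (fun _ => hX)
    ⟨biproduct.ι (fun _ : Unit => X) (), biproduct.π (fun _ : Unit => X) (), by simp⟩

lemma addClosure_of_retract {U : ObjectProperty C} {X Y : C} (r : Retract X Y)
    (hY : addClosure U Y) : addClosure U X := by
  obtain ⟨k, Z, hZ, ⟨s⟩⟩ := hY
  exact ⟨k, Z, hZ, ⟨r.trans s⟩⟩

lemma addClosure_mono {U V : ObjectProperty C} (h : U ≤ V) : addClosure U ≤ addClosure V := by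
  rintro X ⟨k, Y, hY, r⟩
  exact ⟨k, Y, fun i => h _ (hY i), r⟩

/-- The biproduct of a finite family of retracts, which makes `addClosure` idempotent. -/
noncomputable def retractBiproduct {ι : Type} [Finite ι] {X Y : ι → C}
    (r : ∀ i, Retract (X i) (Y i)) : Retract (⨁ X) (⨁ Y) where
  i := biproduct.map fun i => (r i).i
  r := biproduct.map fun i => (r i).r
  retract := by ext; simp

lemma addClosure_addClosure_le (U : ObjectProperty C) :
    addClosure (addClosure U) ≤ addClosure U := by
  rintro X ⟨k, Y, hY, ⟨r⟩⟩
  choose l Z hZ s using hY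
  refine addClosure_of_finite (ι := Σ i : Fin k, Fin (l i)) (fun p => Z p.1 p.2)
    (fun p => hZ _ _) ?_
  exact (r.trans (retractBiproduct fun i => (s i).some)).trans
    (Retract.ofIso (biproductBiproductIso (fun i : Fin k => Fin (l i)) (fun i j => Z i j)))

lemma addClosure_le_addClosure {U V : ObjectProperty C} (h : U ≤ addClosure V) :
    addClosure U ≤ addClosure V :=
  (addClosure_mono h).trans (addClosure_addClosure_le V)

lemma addClosure_biprod {U : ObjectProperty C} {X Y : C} (hX : addClosure U X)
    (hY : addClosure U Y) : addClosure U (X ⊞ Y) := by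
  apply addClosure_addClosure_le
  let Z : Bool → C := fun b => bif b then X else Y
  refine addClosure_of_finite Z (fun b => by cases b <;> assumption)
    ⟨biprod.desc (biproduct.ι Z true) (biproduct.ι Z false),
      biprod.lift (biproduct.π Z true) (biproduct.π Z false), ?_⟩
  ext <;> simp <;> rfl

lemma addClosure_map {U : ObjectProperty C} {V : ObjectProperty D} (F : C ⥤ D) [F.Additive]
    (h : ∀ X, U X → V (F.obj X)) {X : C} (hX : addClosure U X) : addClosure V (F.obj X) := by
  obtain ⟨k, Y, hY, ⟨r⟩⟩ := hX
  exact ⟨k, fun i => F.obj (Y i), fun i => h _ (hY i),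
    ⟨(r.map F).trans (Retract.ofIso (F.mapBiproduct Y))⟩⟩

lemma singleton_map {C : Type u} [Category.{v} C] {D : Type u'} [Category.{v'} D] (F : C ⥤ D)
    (T X : C) (h : ObjectProperty.singleton T X) :
    ObjectProperty.singleton (F.obj T) (F.obj X) := by
  rw [ObjectProperty.singleton_iff] at h ⊢
  rw [h]

end AddClosure

section InfimaOfNaturals

lemma iInf_natCast_le_of_imp {P Q : ℕ → Prop} (h : ∀ d, P d → Q d) :
    (⨅ (d : ℕ) (_ : Q d), (d : ℕ∞)) ≤ ⨅ (d : ℕ) (_ : P d), (d : ℕ∞) :=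
  le_iInf₂ fun d hd => iInf₂_le d (h d hd)

lemma iInf_natCast_le_mul_sub_one {P Q : ℕ → Prop} {n : ℕ} (hn : 0 < n)
    (h : ∀ d, P d → Q (n * (d + 1) - 1)) :
    (⨅ (d : ℕ) (_ : Q d), (d : ℕ∞)) ≤ n * ((⨅ (d : ℕ) (_ : P d), (d : ℕ∞)) + 1) - 1 := by
  classical
  by_cases hP : ∃ d, P d
  · have hmin : (⨅ (d : ℕ) (_ : P d), (d : ℕ∞)) = (Nat.find hP : ℕ) :=
      le_antisymm (iInf₂_le _ (Nat.find_spec hP))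
        (le_iInf₂ fun d hd => Nat.cast_le.mpr (Nat.find_min' hP hd))
    rw [hmin]
    exact (iInf₂_le _ (h _ (Nat.find_spec hP))).trans (by norm_cast)
  · have htop : (⨅ (d : ℕ) (_ : P d), (d : ℕ∞)) = ⊤ :=
      iInf₂_eq_top.mpr fun d hd => absurd ⟨d, hd⟩ hP
    rw [htop, top_add, ENat.mul_top (by exact_mod_cast hn.ne'), ENat.top_sub_one]
    exact le_top

end InfimaOfNaturals

section ExtensionDimension

universe v' u'

variable {C : Type u} [Category.{v} C] [Abelian C] {D : Type u'} [Category.{v'} D] [Abelian D]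

attribute [local instance] Abelian.hasFiniteBiproducts

lemma extensionLevel_add_two (U : ObjectProperty C) (n : ℕ) : extensionLevel U (n + 2) =
    addClosure fun A => ∃ S : ShortComplex C, S.ShortExact ∧ addClosure U S.X₁ ∧
      extensionLevel U (n + 1) S.X₃ ∧ S.X₂ = A := rfl

lemma addClosure_extensionLevel_le (U : ObjectProperty C) :
    ∀ n, addClosure (extensionLevel U n) ≤ extensionLevel U n
  | 0 => by
    rintro X ⟨k, Y, hY, ⟨r⟩⟩
    have hsum : IsZero (⨁ Y) := by
      rw [IsZero.iff_id_eq_zero]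
      ext i j
      exact (show IsZero (Y _) from hY _).eq_of_src _ _
    refine (IsZero.iff_id_eq_zero X).mpr ?_
    rw [← r.retract, hsum.eq_of_src r.r 0, comp_zero]
  | 1 => addClosure_addClosure_le U
  | n + 2 => by
    rw [extensionLevel_add_two]
    exact addClosure_addClosure_le _

lemma extensionLevel_of_retract {U : ObjectProperty C} {n : ℕ} {X Y : C} (r : Retract X Y)
    (h : extensionLevel U n Y) : extensionLevel U n X :=
  addClosure_extensionLevel_le U n _ (addClosure_of_retract r (le_addClosure _ _ h))

lemma extensionLevel_biproduct {U : ObjectProperty C} {n k : ℕ} {X : Fin k → C}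
    (h : ∀ i, extensionLevel U n (X i)) : extensionLevel U n (⨁ X) :=
  addClosure_extensionLevel_le U n _ ⟨k, X, h, ⟨Retract.refl _⟩⟩

lemma extensionLevel_add_two_of_isExtension {U : ObjectProperty C} {n : ℕ} {A X B : C}
    (h : IsExtension A X B) (hA : addClosure U A) (hB : extensionLevel U (n + 1) B) :
    extensionLevel U (n + 2) X := by
  obtain ⟨f, g, w, h⟩ := h
  rw [extensionLevel_add_two]
  exact le_addClosure _ _ ⟨_, h, hA, hB, rfl⟩

lemma exists_isExtension_of_extensionLevel_add_two {U : ObjectProperty C} {n : ℕ} {X : C}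
    (h : extensionLevel U (n + 2) X) : ∃ A Y B, Nonempty (Retract X Y) ∧ IsExtension A Y B ∧
      addClosure U A ∧ extensionLevel U (n + 1) B := by
  obtain ⟨k, Y, hY, r⟩ := h
  choose S hS h₁ h₃ h₂ using hY
  refine ⟨⨁ (fun i => (S i).X₁), ⨁ Y, ⨁ (fun i => (S i).X₃), r, ?_,
    extensionLevel_biproduct (n := 1) h₁, extensionLevel_biproduct h₃⟩
  obtain rfl : Y = fun i => (S i).X₂ := funext fun i => (h₂ i).symm
  exact IsExtension.biproduct fun i => IsExtension.of_shortExact (hS i)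

lemma extensionLevel_add_of_isExtension {U : ObjectProperty C} (a : ℕ) {b : ℕ} {A X B : C}
    (h : IsExtension A X B) (hA : extensionLevel U a A) (hB : extensionLevel U b B) :
    extensionLevel U (b + a) X := by
  induction a generalizing A X B with
  | zero =>
    obtain ⟨e⟩ := h.nonempty_iso_of_isZero_left hA
    exact extensionLevel_of_retract (Retract.ofIso e) hB
  | succ a ih =>
    cases a with
    | zero =>
      cases b with
      | zero =>
        obtain ⟨e⟩ := h.nonempty_iso_of_isZero_right hB
        exact extensionLevel_of_retract (n := 0 + 1) (Retract.ofIso e.symm) hA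
      | succ b => exact extensionLevel_add_two_of_isExtension h hA hB
    | succ a =>
      obtain ⟨V, Y, W, ⟨r⟩, hY, hV, hW⟩ := exists_isExtension_of_extensionLevel_add_two hA
      obtain ⟨X', h', ⟨r'⟩⟩ := h.exists_retract_left r
      obtain ⟨Z, hVX', hWZ⟩ := hY.exists_quotient h'
      exact extensionLevel_of_retract r'
        (extensionLevel_add_two_of_isExtension (n := b + a) hVX' hV (ih hWZ hW hB))

lemma extensionLevel_map {U : ObjectProperty C} {V : ObjectProperty D} (F : C ⥤ D) [F.Additive]
    [PreservesFiniteLimits F] [PreservesFiniteColimits F] (h : ∀ X, U X → V (F.obj X)) (n : ℕ)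
    {X : C} (hX : extensionLevel U n X) : extensionLevel V n (F.obj X) := by
  induction n generalizing X with
  | zero => exact F.map_isZero hX
  | succ n ih =>
    cases n with
    | zero => exact addClosure_map F h hX
    | succ n =>
      obtain ⟨A, Y, B, ⟨r⟩, hY, hA, hB⟩ := exists_isExtension_of_extensionLevel_add_two hX
      exact extensionLevel_of_retract (r.map F)
        (extensionLevel_add_two_of_isExtension (hY.map F) (addClosure_map F h hA) (ih hB))

theorem extensionDimension_le_of_exact (F : D ⥤ C) [F.Additive] [PreservesFiniteLimits F]
    [PreservesFiniteColimits F] [F.EssSurj] : extensionDimension C ≤ extensionDimension D := by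
  refine iInf_natCast_le_of_imp ?_
  rintro d ⟨T, hT⟩
  exact ⟨F.obj T, fun X => extensionLevel_of_retract (Retract.ofIso (F.objObjPreimageIso X).symm)
    (extensionLevel_map F (singleton_map F T) _ (hT _))⟩

lemma extensionLevel_mul_of_isZero_iterate {U : ObjectProperty C} {l : ℕ} (E Q : C → C)
    (hE : ∀ X, IsExtension (E X) X (Q X)) (hQ : ∀ X, extensionLevel U l (Q X)) (j : ℕ) {X : C}
    (hX : IsZero (E^[j] X)) : extensionLevel U (j * l) X := by
  induction j generalizing X with
  | zero => rwa [zero_mul]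
  | succ j ih =>
    rw [add_mul, one_mul, add_comm]
    exact extensionLevel_add_of_isExtension _ (hE X) (ih hX) (hQ X)

/-- The objects `E^[j] X` form a filtration of `X` of length `n` whose layers lie in the image of
the exact functor `Z`. -/
theorem extensionDimension_le_of_filtration (Z : C ⥤ D) [Z.Additive] [PreservesFiniteLimits Z]
    [PreservesFiniteColimits Z] (E : D → D) (Q : D → C)
    (hE : ∀ X, IsExtension (E X) X (Z.obj (Q X))) {n : ℕ} (hn : 0 < n)
    (h : ∀ X, IsZero (E^[n] X)) :
    extensionDimension D ≤ n * (extensionDimension C + 1) - 1 := by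
  refine iInf_natCast_le_mul_sub_one hn ?_
  rintro d ⟨T, hT⟩
  refine ⟨Z.obj T, fun X => ?_⟩
  rw [Nat.sub_add_cancel (Nat.mul_pos hn d.succ_pos)]
  exact extensionLevel_mul_of_isZero_iterate E (fun X => Z.obj (Q X)) hE
    (fun X => extensionLevel_map Z (singleton_map Z T) _ (hT _)) n (h X)

end ExtensionDimension

section Resolutions

universe v' u'

variable {C : Type u} [Category.{v} C] [Abelian C] {D : Type u'} [Category.{v'} D] [Abelian D]

/-- `HasResolutionOfLength V s K`: there is an exact sequence `0 → X (s - 1) → ⋯ → X 0 → K → 0`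
with all `X i` in `V`. Unlike in `HasResolution`, the length `s` counts the terms, so that
lengths add up, and the sequence is split recursively into short exact sequences. -/
def HasResolutionOfLength (V : ObjectProperty C) : ℕ → C → Prop
  | 0, K => IsZero K
  | s + 1, K => ∃ L Y, V Y ∧ IsExtension L Y K ∧ HasResolutionOfLength V s L

namespace HasResolutionOfLength

lemma mono {V W : ObjectProperty C} (h : V ≤ W) {s : ℕ} {K : C}
    (hK : HasResolutionOfLength V s K) : HasResolutionOfLength W s K := by
  induction s generalizing K with
  | zero => exact hK
  | succ s ih =>
    obtain ⟨L, Y, hY, hL, hL'⟩ := hK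
    exact ⟨L, Y, h _ hY, hL, ih hL'⟩

lemma of_iso {V : ObjectProperty C} {s : ℕ} {K K' : C} (hK : HasResolutionOfLength V s K)
    (e : K ≅ K') : HasResolutionOfLength V s K' := by
  cases s with
  | zero => exact IsZero.of_iso hK e.symm
  | succ s =>
    obtain ⟨L, Y, hY, hL, hL'⟩ := hK
    exact ⟨L, Y, hY, hL.of_iso (Iso.refl _) (Iso.refl _) e, hL'⟩

protected lemma map {V : ObjectProperty C} {W : ObjectProperty D} (F : C ⥤ D) [F.Additive]
    [PreservesFiniteLimits F] [PreservesFiniteColimits F] (h : ∀ X, V X → W (F.obj X)) {s : ℕ}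
    {K : C} (hK : HasResolutionOfLength V s K) : HasResolutionOfLength W s (F.obj K) := by
  induction s generalizing K with
  | zero => exact F.map_isZero hK
  | succ s ih =>
    obtain ⟨L, Y, hY, hL, hL'⟩ := hK
    exact ⟨_, _, h _ hY, hL.map F, ih hL'⟩

lemma of_complex {V : ObjectProperty C} (s : ℕ) {K : C} (X : ℕ → C)
    (d : ∀ i, X (i + 1) ⟶ X i) (ε : X 0 ⟶ K) (w₀ : d 0 ≫ ε = 0) (w : ∀ i, d (i + 1) ≫ d i = 0)
    (hV : ∀ i < s, V (X i)) (hX : ∀ i, s ≤ i → IsZero (X i)) (hε : Epi ε)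
    (h₀ : (ShortComplex.mk (d 0) ε w₀).Exact)
    (h : ∀ i, (ShortComplex.mk (d (i + 1)) (d i) (w i)).Exact) :
    HasResolutionOfLength V s K := by
  induction s generalizing K X with
  | zero =>
    refine (IsZero.iff_id_eq_zero K).mpr ?_
    rw [← cancel_epi ε]
    exact (hX 0 le_rfl).eq_of_src _ _
  | succ s ih =>
    have w₁ : d 1 ≫ kernel.lift ε (d 0) w₀ = 0 := by
      rw [← cancel_mono (kernel.ι ε), Category.assoc, kernel.lift_ι, zero_comp, w 0]
    let φ : ShortComplex.mk (d 1) (kernel.lift ε (d 0) w₀) w₁ ⟶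
        ShortComplex.mk (d 1) (d 0) (w 0) :=
      { τ₁ := 𝟙 _, τ₂ := 𝟙 _, τ₃ := kernel.ι ε }
    have h₁ : (ShortComplex.mk (d 1) (kernel.lift ε (d 0) w₀) w₁).Exact :=
      (ShortComplex.exact_iff_of_epi_of_isIso_of_mono φ).mpr (h 0)
    exact ⟨kernel ε, X 0, hV 0 s.succ_pos, IsExtension.kernel ε,
      ih (fun i => X (i + 1)) (fun i => d (i + 1)) (kernel.lift ε (d 0) w₀) w₁ (fun i => w _)
        (fun i hi => hV _ (by lia)) (fun i hi => hX _ (by lia)) h₀.epi_kernelLift h₁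
        (fun i => h _)⟩

lemma exists_complex {V : ObjectProperty C} {s : ℕ} {K : C} (hK : HasResolutionOfLength V s K) :
    ∃ (X : ℕ → C) (d : ∀ i, X (i + 1) ⟶ X i) (ε : X 0 ⟶ K) (w₀ : d 0 ≫ ε = 0)
      (w : ∀ i, d (i + 1) ≫ d i = 0), (∀ i < s, V (X i)) ∧ (∀ i, s ≤ i → IsZero (X i)) ∧ Epi ε ∧
      (ShortComplex.mk (d 0) ε w₀).Exact ∧
      ∀ i, (ShortComplex.mk (d (i + 1)) (d i) (w i)).Exact := by
  induction s generalizing K with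
  | zero =>
    have hK' : IsZero K := hK
    exact ⟨fun _ => K, fun _ => 0, 0, by simp, fun _ => by simp, by simp, fun _ _ => hK',
      ⟨fun _ _ _ => hK'.eq_of_src _ _⟩, ShortComplex.exact_of_isZero_X₂ _ hK',
      fun i => ShortComplex.exact_of_isZero_X₂ _ hK'⟩
  | succ s ih =>
    obtain ⟨L, Y, hY, ⟨f, g, w, h⟩, hL⟩ := hK
    obtain ⟨X, d, ε, w₀, wX, hV, hX, hε, h₀, hd⟩ := ih hL
    have : Mono f := h.mono_f
    have wg : (ε ≫ f) ≫ g = 0 := by rw [Category.assoc, w, comp_zero]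
    have wf : d 0 ≫ ε ≫ f = 0 := by rw [reassoc_of% w₀, zero_comp]
    let φ : ShortComplex.mk (ε ≫ f) g wg ⟶ ShortComplex.mk f g w :=
      { τ₁ := ε, τ₂ := 𝟙 _, τ₃ := 𝟙 _ }
    let ψ : ShortComplex.mk (d 0) ε w₀ ⟶ ShortComplex.mk (d 0) (ε ≫ f) wf :=
      { τ₁ := 𝟙 _, τ₂ := 𝟙 _, τ₃ := f }
    refine ⟨fun i => Nat.casesOn i Y X, fun i => Nat.casesOn i (ε ≫ f) d, g, wg, ?_, ?_, ?_,
      h.epi_g, (ShortComplex.exact_iff_of_epi_of_isIso_of_mono φ).mpr h.exact, ?_⟩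
    · rintro (_ | i)
      exacts [wf, wX i]
    · rintro (_ | i) hi
      exacts [hY, hV i (by lia)]
    · rintro (_ | i) hi
      exacts [absurd hi (by lia), hX i (by lia)]
    · rintro (_ | i)
      exacts [(ShortComplex.exact_iff_of_epi_of_isIso_of_mono ψ).mp h₀, hd i]

end HasResolutionOfLength

lemma hasResolution_iff_hasResolutionOfLength (V : ObjectProperty C) (m : ℕ) (K : C) :
    HasResolution V m K ↔ HasResolutionOfLength V (m + 1) K := by
  constructor
  · rintro ⟨X, d, ε, w₀, w, hV, hX, hε, h₀, hd⟩
    exact .of_complex (m + 1) X d ε w₀ w (fun i hi => hV i (Nat.le_of_lt_succ hi)) hX hε h₀ hd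
  · intro h
    obtain ⟨X, d, ε, w₀, w, hV, hX, hε, h₀, hd⟩ := h.exists_complex
    exact ⟨X, d, ε, w₀, w, fun i hi => hV i (Nat.lt_succ_of_le hi), hX, hε, h₀, hd⟩

end Resolutions

section Syzygies

universe v' u'

variable {C : Type u} [Category.{v} C] [Abelian C] {D : Type u'} [Category.{v'} D] [Abelian D]

attribute [local instance] Abelian.hasFiniteBiproducts

open ZeroObject

/-- `add U` for a single object `U`. -/
abbrev addObj (U : C) : ObjectProperty C := addClosure (ObjectProperty.singleton U)

lemma addObj_self (U : C) : addObj U U :=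
  le_addClosure _ _ ((ObjectProperty.singleton_iff _ _).mpr rfl)

lemma addObj_le {U : C} {V : ObjectProperty C} (h : addClosure V U) : addObj U ≤ addClosure V :=
  addClosure_le_addClosure fun X hX => by
    rw [ObjectProperty.singleton_iff] at hX
    rwa [← hX]

lemma addObj_le_biprod_left (U V : C) : addObj U ≤ addObj (U ⊞ V) :=
  addObj_le (addClosure_of_retract ⟨biprod.inl, biprod.fst, biprod.inl_fst⟩ (addObj_self _))

lemma addObj_le_biprod_right (U V : C) : addObj V ≤ addObj (U ⊞ V) :=
  addObj_le (addClosure_of_retract ⟨biprod.inr, biprod.snd, biprod.inr_snd⟩ (addObj_self _))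

lemma isSyzygy_succ_iff (n : ℕ) (X K : C) : IsSyzygy (n + 1) X K ↔
    ∃ Y P, IsSyzygy n X Y ∧ Projective P ∧ IsExtension K P Y := by
  constructor
  · rintro ⟨Y, hY, S, hS, hP, ⟨e⟩, ⟨e'⟩⟩
    exact ⟨Y, S.X₂, hY, hP, (IsExtension.of_shortExact hS).of_iso e (Iso.refl _) e'⟩
  · rintro ⟨Y, P, hY, hP, ⟨f, g, w, h⟩⟩
    exact ⟨Y, hY, _, h, hP, ⟨Iso.refl _⟩, ⟨Iso.refl _⟩⟩

lemma IsSyzygy.of_iso {n : ℕ} {X X' K : C} (h : IsSyzygy n X K) (e : X ≅ X') :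
    IsSyzygy n X' K := by
  induction n generalizing K with
  | zero =>
    obtain ⟨i⟩ := h
    exact ⟨i ≪≫ e⟩
  | succ n ih =>
    rw [isSyzygy_succ_iff] at h ⊢
    obtain ⟨Y, P, hY, h⟩ := h
    exact ⟨Y, P, ih hY, h⟩

protected lemma IsSyzygy.map {n : ℕ} {X K : C} (h : IsSyzygy n X K) (F : C ⥤ D) [F.Additive]
    [PreservesFiniteLimits F] [PreservesFiniteColimits F]
    (hF : ∀ P, Projective P → Projective (F.obj P)) : IsSyzygy n (F.obj X) (F.obj K) := by
  induction n generalizing K with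
  | zero =>
    obtain ⟨i⟩ := h
    exact ⟨F.mapIso i⟩
  | succ n ih =>
    rw [isSyzygy_succ_iff] at h ⊢
    obtain ⟨Y, P, hY, hP, h⟩ := h
    exact ⟨_, _, ih hY, hF _ hP, h.map F⟩

lemma isSyzygy_of_isZero (n : ℕ) {X K : C} (hX : IsZero X) (hK : IsZero K) : IsSyzygy n X K := by
  induction n generalizing K with
  | zero => exact ⟨hK.iso hX⟩
  | succ n ih =>
    rw [isSyzygy_succ_iff]
    exact ⟨K, K, ih hK, hK.projective, .of_isZero hK hK hK⟩

lemma IsExtension.exists_isSyzygy (n : ℕ) {A B Q K K' : C} (h : IsExtension A B Q)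
    (hA : IsSyzygy n A K) (hB : IsSyzygy n B K') :
    ∃ P L, Projective P ∧ IsSyzygy n Q L ∧ IsExtension K (K' ⊞ P) L := by
  induction n generalizing K K' with
  | zero =>
    obtain ⟨i⟩ := hA
    obtain ⟨j⟩ := hB
    exact ⟨0, Q, inferInstance, ⟨Iso.refl _⟩,
      h.of_iso i.symm (j.symm ≪≫ isoBiprodZero (isZero_zero C)) (Iso.refl _)⟩
  | succ n ih =>
    rw [isSyzygy_succ_iff] at hA hB
    obtain ⟨Y, P, hY, hP, hK⟩ := hA
    obtain ⟨Y', P', hY', hP', hK'⟩ := hB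
    obtain ⟨P₀, L, hP₀, hL, h₀⟩ := ih hY hY'
    obtain ⟨N, hN, hN'⟩ := (hK'.biprod_right P₀).exists_kernel h₀
    exact ⟨P, N, hP, (isSyzygy_succ_iff _ _ _).mpr ⟨L, _, hL, inferInstance, hN⟩, hN'.rotate hK⟩

/-- As in Schanuel's lemma, each of the two projective covers lifts along the other. -/
lemma IsExtension.nonempty_retract_of_projective {K P X L R Y : C} [Projective P] [Projective R]
    (h : IsExtension K P X) (h' : IsExtension L R Y) (r : Retract X Y) :
    Nonempty (Retract K (L ⊞ P)) := by
  obtain ⟨i, p, w, h⟩ := h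
  obtain ⟨j, q, w', h'⟩ := h'
  have : Mono i := h.mono_f
  have : Mono j := h'.mono_f
  have : Epi p := h.epi_g
  have : Epi q := h'.epi_g
  let a : P ⟶ R := Projective.factorThru (p ≫ r.i) q
  let b : R ⟶ P := Projective.factorThru (q ≫ r.r) p
  have ha : a ≫ q = p ≫ r.i := Projective.factorThru_comp _ _
  have hb : b ≫ p = q ≫ r.r := Projective.factorThru_comp _ _
  have h₁ : (i ≫ a) ≫ q = 0 := by simp [ha, reassoc_of% w]
  have h₂ : (j ≫ b) ≫ p = 0 := by simp [hb, reassoc_of% w']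
  have h₃ : (𝟙 P - a ≫ b) ≫ p = 0 := by simp [hb, reassoc_of% ha]
  have lift₁ : h'.exact.lift _ h₁ ≫ j = i ≫ a := h'.exact.lift_f _ _
  have lift₂ : h.exact.lift _ h₂ ≫ i = j ≫ b := h.exact.lift_f _ _
  have lift₃ : h.exact.lift _ h₃ ≫ i = 𝟙 P - a ≫ b := h.exact.lift_f _ _
  refine ⟨⟨biprod.lift (h'.exact.lift _ h₁) i,
    biprod.desc (h.exact.lift _ h₂) (h.exact.lift _ h₃), ?_⟩⟩
  rw [← cancel_mono i, biprod.lift_desc, Preadditive.add_comp, Category.assoc, Category.assoc,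
    lift₂, lift₃, reassoc_of% lift₁]
  simp

lemma projective_biproduct {ι : Type} [Finite ι] (P : ι → C) [∀ i, Projective (P i)] :
    Projective (⨁ P) where
  factors f e _ :=
    ⟨biproduct.desc fun i => Projective.factorThru (biproduct.ι P i ≫ f) e, by ext; simp⟩

section ProjectiveGenerator

variable {G : C} (hG : ∀ P : C, Projective P → addObj G P)

include hG

lemma HasResolutionOfLength.biprod_projective {U : C} {a : ℕ} {K P : C} (hP : Projective P)
    (hK : HasResolutionOfLength (addObj U) (a + 1) K) :
    HasResolutionOfLength (addObj (U ⊞ G)) (a + 1) (K ⊞ P) := by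
  obtain ⟨L, Y, hY, hL, hL'⟩ := hK
  exact ⟨L, _, addClosure_biprod (addObj_le_biprod_left _ _ _ hY)
    (addObj_le_biprod_right _ _ _ (hG _ hP)), hL.biprod_right P,
    hL'.mono (addObj_le_biprod_left _ _)⟩

variable [EnoughProjectives C]

lemma exists_addObj_syzygy (U : C) : ∃ U' : C, addObj G ≤ addObj U' ∧
    ∀ K P X, Projective P → IsExtension K P X → addObj U X → addObj U' K := by
  let π := Projective.π U
  refine ⟨kernel π ⊞ G, addObj_le_biprod_right _ _, ?_⟩
  rintro K P X hP h ⟨k, Y, hY, ⟨r⟩⟩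
  obtain rfl : Y = fun _ => U := funext fun i => ((ObjectProperty.singleton_iff _ _).mp (hY i)).symm
  have := projective_biproduct fun _ : Fin k => Projective.over U
  obtain ⟨s⟩ := h.nonempty_retract_of_projective
    (IsExtension.biproduct fun _ : Fin k => IsExtension.kernel π) r
  have hker : addObj (kernel π) (⨁ fun _ : Fin k => kernel π) :=
    ⟨k, _, fun _ => (ObjectProperty.singleton_iff _ _).mpr rfl, ⟨Retract.refl _⟩⟩
  exact addClosure_of_retract s (addClosure_biprod (addObj_le_biprod_left _ _ _ hker)
    (addObj_le_biprod_right _ _ _ (hG _ hP)))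

lemma exists_hasResolutionOfLength_syzygy (U : C) :
    ∃ U' : C, ∀ c X, HasResolutionOfLength (addObj U) c X →
      ∃ L P, Projective P ∧ IsExtension L P X ∧ HasResolutionOfLength (addObj U') c L := by
  obtain ⟨U', hGU', hU'⟩ := exists_addObj_syzygy hG U
  refine ⟨U', fun c => ?_⟩
  induction c with
  | zero =>
    intro X (hX : IsZero X)
    exact ⟨X, X, hX.projective, .of_isZero hX hX hX, hX⟩
  | succ c ih =>
    rintro X ⟨K, Y, hY, hK, hK'⟩
    obtain ⟨O, P, hP, hO, hO'⟩ := ih K hK'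
    have hker := IsExtension.kernel (Projective.π Y)
    obtain ⟨L, hL, hL'⟩ := hker.exists_kernel hK
    exact ⟨L, _, inferInstance, hL, O, _, addClosure_biprod (hU' _ _ _ inferInstance hker hY)
      (hGU' _ (hG _ hP)), hL'.rotate hO, hO'⟩

lemma exists_hasResolutionOfLength_extension (a : ℕ) (U W : C) : ∃ U' : C,
    addObj U ≤ addObj U' ∧ addObj G ≤ addObj U' ∧ ∀ c A B Q, IsExtension A B Q →
      HasResolutionOfLength (addObj U) a A → HasResolutionOfLength (addObj W) c Q →
        HasResolutionOfLength (addObj U') (c + a) B := by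
  induction a generalizing W with
  | zero =>
    refine ⟨W ⊞ (U ⊞ G), (addObj_le_biprod_left _ _).trans (addObj_le_biprod_right _ _),
      (addObj_le_biprod_right _ _).trans (addObj_le_biprod_right _ _), ?_⟩
    intro c A B Q h hA hQ
    obtain ⟨e⟩ := h.nonempty_iso_of_isZero_left hA
    exact (hQ.of_iso e.symm).mono (addObj_le_biprod_left _ _)
  | succ a ih =>
    obtain ⟨W', hW'⟩ := exists_hasResolutionOfLength_syzygy hG W
    obtain ⟨U', hU, hGU', hU'⟩ := ih W'
    refine ⟨U', hU, hGU', ?_⟩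
    rintro c A B Q h ⟨A', V, hV, hA, hA'⟩ hQ
    obtain ⟨L, P, hP, hL, hL'⟩ := hW' _ _ hQ
    obtain ⟨N, hN, hN'⟩ := hA.horseshoe h hL
    exact ⟨N, _, addClosure_biprod (hU _ hV) (hGU' _ (hG _ hP)), hN, hU' _ _ _ _ hN' hA' hL'⟩

lemma exists_hasResolutionOfLength_quotient (a : ℕ) (U W : C) : ∃ U' : C,
    ∀ c A B Q, IsExtension A B Q → HasResolutionOfLength (addObj U) (a + 1) B →
      HasResolutionOfLength (addObj W) c A →
        HasResolutionOfLength (addObj U') (c + (a + 1)) Q := by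
  obtain ⟨U', hU, -, hU'⟩ := exists_hasResolutionOfLength_extension hG a U W
  refine ⟨U', ?_⟩
  rintro c A B Q h ⟨K, V, hV, hB, hK⟩ hA
  obtain ⟨N, hN, hN'⟩ := hB.exists_kernel h
  exact ⟨N, V, hU _ hV, hN, hU' _ _ _ _ hN' hK hA⟩

lemma exists_hasResolutionOfLength_of_isZero_iterate {k m : ℕ} {U : C} (E T : C → C)
    (hE : ∀ X, IsExtension (E X) (T X) X)
    (hT : ∀ X, ∃ L, IsSyzygy k (T X) L ∧ HasResolutionOfLength (addObj U) (m + 1) L) (j : ℕ) :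
    ∃ U' : C, ∀ X, IsZero (E^[j] X) →
      ∃ K, IsSyzygy k X K ∧ HasResolutionOfLength (addObj U') (j * (m + 1)) K := by
  induction j with
  | zero =>
    refine ⟨0, fun X hX => ⟨0, isSyzygy_of_isZero k hX (isZero_zero C), ?_⟩⟩
    rw [zero_mul]
    exact isZero_zero C
  | succ j ih =>
    obtain ⟨W, hW⟩ := ih
    obtain ⟨U', hU'⟩ := exists_hasResolutionOfLength_quotient hG m (U ⊞ G) W
    refine ⟨U', fun X hX => ?_⟩
    obtain ⟨K, hK, hK'⟩ := hW _ hX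
    obtain ⟨L, hL, hL'⟩ := hT X
    obtain ⟨P, N, hP, hN, hKLN⟩ := (hE X).exists_isSyzygy k hK hL
    rw [add_mul, one_mul]
    exact ⟨N, hN, hU' _ _ _ _ hKLN (hL'.biprod_projective hG hP) hK'⟩

/-- The objects `E^[j] X` cut out a resolution of `X` of length `n` whose terms lie in the image of
the exact functor `T`. -/
theorem igusaTodorovDistance_le_of_filtration (T : D ⥤ C) [T.Additive] [PreservesFiniteLimits T]
    [PreservesFiniteColimits T] (hT : ∀ P, Projective P → Projective (T.obj P))
    (E : C → C) (R : C → D) (hE : ∀ X, IsExtension (E X) (T.obj (R X)) X) {n : ℕ} (hn : 0 < n)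
    (h : ∀ X, IsZero (E^[n] X)) :
    igusaTodorovDistance C ≤ n * (igusaTodorovDistance D + 1) - 1 := by
  refine iInf_natCast_le_mul_sub_one hn ?_
  rintro m ⟨k, U, hU⟩
  obtain ⟨U', hU'⟩ := exists_hasResolutionOfLength_of_isZero_iterate hG (k := k) (m := m)
    (U := T.obj U) E (fun X => T.obj (R X)) hE (fun X => by
      obtain ⟨L, hL, hL'⟩ := hU (R X)
      rw [hasResolution_iff_hasResolutionOfLength] at hL'
      exact ⟨T.obj L, hL.map T hT, hL'.map T fun _ => addClosure_map T (singleton_map T U)⟩) n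
  refine ⟨k, U', fun X => ?_⟩
  obtain ⟨K, hK, hK'⟩ := hU' X (h X)
  refine ⟨K, hK, ?_⟩
  rwa [hasResolution_iff_hasResolutionOfLength, Nat.sub_add_cancel (Nat.mul_pos hn m.succ_pos)]

end ProjectiveGenerator

theorem igusaTodorovDistance_le_of_exact (F : D ⥤ C) [F.Additive] [PreservesFiniteLimits F]
    [PreservesFiniteColimits F] [F.EssSurj] (hF : ∀ P, Projective P → Projective (F.obj P)) :
    igusaTodorovDistance C ≤ igusaTodorovDistance D := by
  refine iInf_natCast_le_of_imp ?_
  rintro m ⟨k, U, hU⟩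
  refine ⟨k, F.obj U, fun X => ?_⟩
  obtain ⟨K, hK, hK'⟩ := hU (F.objPreimage X)
  refine ⟨F.obj K, (hK.map F hF).of_iso (F.objObjPreimageIso X), ?_⟩
  rw [hasResolution_iff_hasResolutionOfLength] at hK' ⊢
  exact hK'.map F fun _ => addClosure_map F (singleton_map F U)

end Syzygies

section Triangulated

open Pretriangulated

variable {T : Type*} [Category* T] [HasZeroObject T] [HasShift T ℤ] [Preadditive T]
  [∀ n : ℤ, (shiftFunctor T n).Additive] [Pretriangulated T]
  {T' : Type*} [Category* T'] [HasZeroObject T'] [HasShift T' ℤ] [Preadditive T']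
  [∀ n : ℤ, (shiftFunctor T' n).Additive] [Pretriangulated T']

lemma shiftBinaryProductsRetractClosure_le_inverseImage (F : T ⥤ T') [F.CommShift ℤ]
    [F.IsTriangulated] {P : ObjectProperty T} {Q : ObjectProperty T'} (h : P ≤ Q.inverseImage F) :
    (P.shiftClosure ℤ).binaryProductsClosure.retractClosure ≤
      (Q.shiftClosure ℤ).binaryProductsClosure.retractClosure.inverseImage F := by
  rintro X ⟨Y, hY, ⟨r⟩⟩
  refine ⟨F.obj Y, ?_, ⟨r.map F⟩⟩
  suffices (P.shiftClosure ℤ).binaryProductsClosure ≤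
      (Q.shiftClosure ℤ).binaryProductsClosure.inverseImage F from this _ hY
  have : ((Q.shiftClosure ℤ).binaryProductsClosure.inverseImage F).IsClosedUnderLimitsOfShape
      (Discrete WalkingPair) := by
    refine ⟨?_⟩
    rintro X ⟨p⟩
    exact ObjectProperty.prop_of_isLimit _ (isLimitOfPreserves F p.isLimit)
      (fun j => p.prop_diag_obj j)
  refine ObjectProperty.limitsClosure_le (J := fun _ : Unit => Discrete WalkingPair) ?_
  rintro X ⟨Y, a, e, hY⟩
  exact ObjectProperty.le_limitsClosure _ _ _
    ⟨F.obj Y, a, F.mapIso e ≪≫ (F.commShiftIso a).app Y, h _ hY⟩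

lemma triangEnvelopeIter_le_inverseImage (F : T ⥤ T') [F.CommShift ℤ]
    [F.IsTriangulated] {P : ObjectProperty T} {Q : ObjectProperty T'} (h : P ≤ Q.inverseImage F)
    (n : ℕ) : P.triangEnvelopeIter n ≤ (Q.triangEnvelopeIter n).inverseImage F := by
  induction n with
  | zero =>
    simp only [ObjectProperty.triangEnvelopeIter_zero]
    exact shiftBinaryProductsRetractClosure_le_inverseImage F h
  | succ n ih =>
    simp only [ObjectProperty.triangEnvelopeIter_succ]
    rintro X ⟨Y, ⟨A, B, f, g, k, hT, hA, hB⟩, ⟨r⟩⟩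
    exact ⟨F.obj Y, ⟨F.obj A, F.obj B, _, _, _, F.map_distinguished _ hT,
      shiftBinaryProductsRetractClosure_le_inverseImage F h _ hA, ih _ hB⟩, ⟨r.map F⟩⟩

lemma extensionProduct_fullSubcategory {P : ObjectProperty T} [P.IsTriangulated]
    {Q R : ObjectProperty P.FullSubcategory} {A X B : P.FullSubcategory}
    {f : A.obj ⟶ X.obj} {g : X.obj ⟶ B.obj} {h : B.obj ⟶ A.obj⟦(1 : ℤ)⟧}
    (hT : Triangle.mk f g h ∈ distTriang T) (hA : Q A) (hB : R B) :
    ObjectProperty.extensionProduct Q R X := by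
  refine ⟨A, B, P.fullyFaithfulι.preimage f, P.fullyFaithfulι.preimage g,
    P.fullyFaithfulι.preimage (X := B) (Y := A⟦(1 : ℤ)⟧)
      (h ≫ (P.ι.commShiftIso (1 : ℤ)).inv.app A), ?_, hA, hB⟩
  refine isomorphic_distinguished _ hT _ (Triangle.isoMk _ _ (Iso.refl _) (Iso.refl _) (Iso.refl _)
    ?_ ?_ ?_)
  · exact (Category.comp_id f).trans (Category.id_comp f).symm
  · exact (Category.comp_id g).trans (Category.id_comp g).symm
  · change ((h ≫ (P.ι.commShiftIso (1 : ℤ)).inv.app A) ≫ (P.ι.commShiftIso (1 : ℤ)).hom.app A) ≫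
      (shiftFunctor T (1 : ℤ)).map (𝟙 A.obj) = 𝟙 B.obj ≫ h
    simp

end Triangulated

section Bounded

open Pretriangulated DerivedCategory

universe v' u' w w'

variable {C : Type u} [Category.{v} C] [Abelian C]
  {D : Type u'} [Category.{v'} D] [Abelian D]

/-- A cochain complex concentrated in finitely many degrees. -/
def IsStrictlyBounded (K : CochainComplex C ℤ) : Prop :=
  ∃ a b : ℤ, ∀ i, (i < a ∨ b < i) → IsZero (K.X i)

lemma IsStrictlyBounded.map {K : CochainComplex C ℤ} (hK : IsStrictlyBounded K) (F : C ⥤ D)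
    [F.PreservesZeroMorphisms] :
    IsStrictlyBounded ((F.mapHomologicalComplex (ComplexShape.up ℤ)).obj K) := by
  obtain ⟨a, b, h⟩ := hK
  exact ⟨a, b, fun i hi => F.map_isZero (h i hi)⟩

section Filtration

variable (J Q : D ⥤ D) [J.Additive] [Q.Additive] (α : J ⟶ 𝟭 D) (β : 𝟭 D ⟶ Q)
  (w : ∀ X, α.app X ≫ β.app X = 0)

/-- The sequence `J K ⟶ K ⟶ Q K` of complexes obtained by applying a functorial sequence
`J X ⟶ X ⟶ Q X` of objects in each degree. -/
def termwiseShortComplex (K : CochainComplex D ℤ) : ShortComplex (CochainComplex D ℤ) where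
  X₁ := (J.mapHomologicalComplex _).obj K
  X₂ := K
  X₃ := (Q.mapHomologicalComplex _).obj K
  f := (NatTrans.mapHomologicalComplex α _).app K
  g := (NatTrans.mapHomologicalComplex β _).app K
  zero := by
    ext i
    exact w (K.X i)

lemma shortExact_termwiseShortComplex
    (h : ∀ X, (ShortComplex.mk (α.app X) (β.app X) (w X)).ShortExact) (K : CochainComplex D ℤ) :
    (termwiseShortComplex J Q α β w K).ShortExact :=
  HomologicalComplex.shortExact_of_degreewise_shortExact _ fun i => h (K.X i)

end Filtration

variable [HasDerivedCategory.{w} C] [HasDerivedCategory.{w'} D]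

lemma IsStrictlyBounded.bounded {K : CochainComplex C ℤ} (hK : IsStrictlyBounded K) :
    (TStructure.t : Triangulated.TStructure (DerivedCategory C)).bounded (Q.obj K) := by
  obtain ⟨a, b, h⟩ := hK
  have h₁ : K.IsStrictlyGE a := (K.isStrictlyGE_iff a).mpr fun i hi => h i (Or.inl hi)
  have h₂ : K.IsStrictlyLE b := (K.isStrictlyLE_iff b).mpr fun i hi => h i (Or.inr hi)
  exact ⟨⟨a, inferInstance⟩, ⟨b, inferInstance⟩⟩

lemma exists_isStrictlyBounded_iso {X : DerivedCategory C}
    (hX : (TStructure.t : Triangulated.TStructure (DerivedCategory C)).bounded X) :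
    ∃ K : CochainComplex C ℤ, IsStrictlyBounded K ∧ Nonempty (X ≅ Q.obj K) := by
  obtain ⟨⟨a, ha⟩, ⟨b, hb⟩⟩ := hX
  obtain ⟨K, h₁, h₂, e⟩ := exists_iso_Q_obj_of_isGE_of_isLE X a b
  refine ⟨K, ⟨a, b, ?_⟩, e⟩
  rintro i (hi | hi)
  · exact (K.isStrictlyGE_iff a).mp h₁ i hi
  · exact (K.isStrictlyLE_iff b).mp h₂ i hi

/-- The object of the bounded derived category represented by a bounded complex. -/
noncomputable def IsStrictlyBounded.obj {K : CochainComplex C ℤ} (hK : IsStrictlyBounded K) :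
    Bounded C := ⟨Q.obj K, hK.bounded⟩

/-- Isomorphic bounded complexes represent isomorphic objects of the bounded derived category. -/
noncomputable def IsStrictlyBounded.objIso {K L : CochainComplex C ℤ} (hK : IsStrictlyBounded K)
    (hL : IsStrictlyBounded L) (e : K ≅ L) : hK.obj ≅ hL.obj :=
  ObjectProperty.isoMk _ (Q.mapIso e)

lemma exists_iso_isStrictlyBounded_obj (X : Bounded C) :
    ∃ (K : CochainComplex C ℤ) (hK : IsStrictlyBounded K), Nonempty (X ≅ hK.obj) := by
  obtain ⟨K, hK, ⟨e⟩⟩ := exists_isStrictlyBounded_iso X.property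
  exact ⟨K, hK, ⟨ObjectProperty.isoMk _ e⟩⟩

variable (F : C ⥤ D) [F.Additive] [PreservesFiniteLimits F] [PreservesFiniteColimits F]

lemma bounded_mapDerivedCategory_obj (X : Bounded C) :
    (TStructure.t : Triangulated.TStructure (DerivedCategory D)).bounded
      (F.mapDerivedCategory.obj X.obj) := by
  obtain ⟨K, hK, ⟨e⟩⟩ := exists_isStrictlyBounded_iso X.property
  exact ObjectProperty.prop_of_iso _
    (F.mapDerivedCategory.mapIso e ≪≫ F.mapDerivedCategoryFactors.app K).symm (hK.map F).bounded

/-- The functor between bounded derived categories induced by an exact functor. -/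
noncomputable def mapBoundedDerived : Bounded C ⥤ Bounded D :=
  ObjectProperty.lift _ (Bounded.ι ⋙ F.mapDerivedCategory) (bounded_mapDerivedCategory_obj F)

noncomputable instance : (mapBoundedDerived F).CommShift ℤ := by
  dsimp only [mapBoundedDerived]
  infer_instance

instance : (mapBoundedDerived F).IsTriangulated := by
  dsimp only [mapBoundedDerived]
  infer_instance

/-- The functor induced on bounded derived categories is computed termwise on complexes. -/
noncomputable def mapBoundedDerivedObjIso {K : CochainComplex C ℤ} (hK : IsStrictlyBounded K) :
    (mapBoundedDerived F).obj hK.obj ≅ (hK.map F).obj :=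
  ObjectProperty.isoMk _ (F.mapDerivedCategoryFactors.app K)

lemma triangEnvelopeIter_map_obj {G : Bounded C} {d : ℕ}
    (hG : (ObjectProperty.singleton G).triangEnvelopeIter d = ⊤) {K : CochainComplex C ℤ}
    (hK : IsStrictlyBounded K) :
    (ObjectProperty.singleton ((mapBoundedDerived F).obj G)).triangEnvelopeIter d
      (hK.map F).obj := by
  have hGK : (ObjectProperty.singleton G).triangEnvelopeIter d hK.obj := hG ▸ trivial
  exact ObjectProperty.prop_of_iso _ (mapBoundedDerivedObjIso F hK)
    (triangEnvelopeIter_le_inverseImage (mapBoundedDerived F)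
      (singleton_map (mapBoundedDerived F) G) d _ hGK)

theorem rouquierDimension_le_of_exact (Z : D ⥤ C) [Z.Additive] (e : Z ⋙ F ≅ 𝟭 D) :
    rouquierDimension (Bounded D) ≤ rouquierDimension (Bounded C) := by
  refine iInf_natCast_le_of_imp ?_
  rintro d ⟨G, hG⟩
  refine ⟨(mapBoundedDerived F).obj G, eq_top_iff.mpr fun X _ => ?_⟩
  obtain ⟨K, hK, ⟨i⟩⟩ := exists_iso_isStrictlyBounded_obj X
  exact ObjectProperty.prop_of_iso _
    (((hK.map Z).map F).objIso hK ((NatIso.mapHomologicalComplex e _).app K) ≪≫ i.symm)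
    (triangEnvelopeIter_map_obj F hG (hK.map Z))

lemma triangEnvelopeIter_of_shortExact {P : ObjectProperty (Bounded C)}
    {S : ShortComplex (CochainComplex C ℤ)} (hS : S.ShortExact) (h₁ : IsStrictlyBounded S.X₁)
    (h₂ : IsStrictlyBounded S.X₂) (h₃ : IsStrictlyBounded S.X₃) {a b : ℕ}
    (ha : P.triangEnvelopeIter a h₁.obj) (hb : P.triangEnvelopeIter b h₃.obj) :
    P.triangEnvelopeIter (a + 1 + b) h₂.obj := by
  rw [P.triangEnvelopeIter_add (n := a + 1) (m := b) (n' := a)]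
  exact ObjectProperty.le_retractClosure _ _
    (extensionProduct_fullSubcategory (A := h₁.obj) (X := h₂.obj) (B := h₃.obj)
      (triangleOfSES_distinguished hS) ha hb)

lemma triangEnvelopeIter_of_isZero_iterate {P : ObjectProperty (Bounded C)} {d : ℕ}
    (J Q : C ⥤ C) [J.Additive] [Q.Additive] (α : J ⟶ 𝟭 C) (β : 𝟭 C ⟶ Q)
    (w : ∀ X, α.app X ≫ β.app X = 0)
    (h : ∀ X, (ShortComplex.mk (α.app X) (β.app X) (w X)).ShortExact)
    (hQ : ∀ {K : CochainComplex C ℤ} (hK : IsStrictlyBounded K),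
      P.triangEnvelopeIter d (hK.map Q).obj) (j : ℕ) {K : CochainComplex C ℤ}
    (hK : IsStrictlyBounded K) (hJ : ∀ i, IsZero (J.obj^[j + 1] (K.X i))) :
    P.triangEnvelopeIter (j * (d + 1) + d) hK.obj := by
  have hS := shortExact_termwiseShortComplex J Q α β w h K
  induction j generalizing K with
  | zero =>
    have : IsIso (termwiseShortComplex J Q α β w K).g := hS.isIso_g_iff.mpr (by
      rw [IsZero.iff_id_eq_zero]
      ext i
      exact (hJ i).eq_of_src _ _)
    rw [zero_mul, zero_add]
    exact ObjectProperty.prop_of_iso _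
      ((hK.map Q).objIso hK (asIso (termwiseShortComplex J Q α β w K).g).symm) (hQ hK)
  | succ j ih =>
    rw [show (j + 1) * (d + 1) + d = j * (d + 1) + d + 1 + d by ring]
    exact triangEnvelopeIter_of_shortExact hS (hK.map J) hK (hK.map Q)
      (ih (hK.map J) hJ (shortExact_termwiseShortComplex J Q α β w h _)) (hQ hK)

theorem rouquierDimension_le_of_filtration (J : D ⥤ D) [J.Additive] (R : D ⥤ C) [R.Additive]
    (α : J ⟶ 𝟭 D) (β : 𝟭 D ⟶ R ⋙ F) (w : ∀ X, α.app X ≫ β.app X = 0)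
    (h : ∀ X, (ShortComplex.mk (α.app X) (β.app X) (w X)).ShortExact) {n : ℕ} (hn : 0 < n)
    (hJ : ∀ X, IsZero (J.obj^[n] X)) :
    rouquierDimension (Bounded D) ≤ n * (rouquierDimension (Bounded C) + 1) - 1 := by
  refine iInf_natCast_le_mul_sub_one hn ?_
  rintro d ⟨G, hG⟩
  refine ⟨(mapBoundedDerived F).obj G, eq_top_iff.mpr fun X _ => ?_⟩
  obtain ⟨K, hK, ⟨i⟩⟩ := exists_iso_isStrictlyBounded_obj X
  obtain ⟨n, rfl⟩ := Nat.exists_eq_add_of_le' hn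
  rw [show (n + 1) * (d + 1) - 1 = n * (d + 1) + d by rw [add_mul]; lia]
  exact ObjectProperty.prop_of_iso _ i.symm
    (triangEnvelopeIter_of_isZero_iterate J (R ⋙ F) α β w h
      (fun hL => triangEnvelopeIter_map_obj F hG (hL.map R)) n hK fun _ => hJ _)

end Bounded

section FGModules

universe v' u'

lemma preservesFiniteLimits_and_colimits_of_shortExact {C : Type u} [Category.{v} C] [Abelian C]
    {D : Type u'} [Category.{v'} D] [Abelian D] (F : C ⥤ D) [F.Additive]
    (hF : ∀ T : ShortComplex C, T.ShortExact → (T.map F).ShortExact) :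
    PreservesFiniteLimits F ∧ PreservesFiniteColimits F :=
  (F.exact_tfae.out 0 3).mp hF

variable {R : Type u} [Ring R] {S : Type u} [Ring S]

attribute [local instance] Abelian.hasFiniteBiproducts

lemma fgModuleCat_isZero_iff_subsingleton (X : FGModuleCat.{u} R) : IsZero X ↔ Subsingleton X := by
  refine ⟨fun h => subsingleton_of_forall_eq 0 fun x => ?_, fun h => ?_⟩
  · exact congrArg (fun f : X ⟶ X => f.hom.hom x) (h.eq_of_src (𝟙 X) 0)
  · rw [IsZero.iff_id_eq_zero]
    ext x
    exact Subsingleton.elim _ _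

lemma module_projective_trans {R S X : Type*} [Ring R] [Ring S] [Module R S] [IsScalarTower R S S]
    [AddCommGroup X] [Module S X] [Module R X] [IsScalarTower R S X] [Module.Projective R S]
    [Module.Projective S X] : Module.Projective R X := by
  classical
  obtain ⟨s, hs⟩ := Module.projective_def'.mp (inferInstance : Module.Projective S X)
  have : Module.Projective R (X →₀ S) := .of_equiv (finsuppLequivDFinsupp (ι := X) (M := S) R).symm
  exact .of_split (s.restrictScalars R) ((Finsupp.linearCombination S id).restrictScalars R)
    (LinearMap.ext fun x => LinearMap.congr_fun hs x)

variable [IsNoetherianRing R] [IsNoetherianRing S]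

instance : (forget₂ (FGModuleCat.{u} R) (ModuleCat.{u} R)).Additive where

lemma fgModuleCat_epi_iff_surjective {X Y : FGModuleCat.{u} R} (f : X ⟶ Y) :
    Epi f ↔ Function.Surjective f.hom.hom := by
  rw [← (forget₂ (FGModuleCat.{u} R) (ModuleCat.{u} R)).epi_map_iff_epi f,
    ModuleCat.epi_iff_surjective]
  rfl

lemma fgModuleCat_shortExact_iff (T : ShortComplex (FGModuleCat.{u} R)) : T.ShortExact ↔
    Function.Injective T.f.hom.hom ∧ Function.Exact T.f.hom.hom T.g.hom.hom ∧
      Function.Surjective T.g.hom.hom := by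
  let F := forget₂ (FGModuleCat.{u} R) (ModuleCat.{u} R)
  constructor
  · intro h
    have hF := h.map_of_exact F
    exact ⟨hF.moduleCat_injective_f,
      (ShortComplex.ShortExact.moduleCat_exact_iff_function_exact _).mp hF.exact,
      hF.moduleCat_surjective_g⟩
  · rintro ⟨hinj, hexact, hsurj⟩
    have hF : (T.map F).ShortExact := ModuleCat.shortComplex_shortExact _ hexact hinj hsurj
    exact ShortComplex.ShortExact.mk' ((T.exact_map_iff_of_faithful F).mp hF.exact)
      (F.mono_of_mono_map hF.mono_f) (F.epi_of_epi_map hF.epi_g)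

lemma isExtension_of_linearMap {X Y Z : FGModuleCat.{u} R} (f : X →ₗ[R] Y) (g : Y →ₗ[R] Z)
    (hf : Function.Injective f) (hfg : Function.Exact f g) (hg : Function.Surjective g) :
    IsExtension X Y Z :=
  ⟨FGModuleCat.ofHom f, FGModuleCat.ofHom g, by ext x; exact hfg.apply_apply_eq_zero x,
    (fgModuleCat_shortExact_iff _).mpr ⟨hf, hfg, hg⟩⟩

lemma fgModuleCat_projective_iff (P : FGModuleCat.{u} R) :
    Projective P ↔ Module.Projective R P := by
  constructor
  · intro _
    obtain ⟨k, r, hr⟩ := Module.Finite.exists_fin' R P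
    let π : FGModuleCat.of R (Fin k → R) ⟶ P := FGModuleCat.ofHom r
    have : Epi π := (fgModuleCat_epi_iff_surjective π).mpr hr
    refine .of_split (Projective.factorThru (𝟙 P) π).hom.hom r ?_
    exact congrArg (fun f : P ⟶ P => f.hom.hom) (Projective.factorThru_comp (𝟙 P) π)
  · refine fun _ => ⟨fun {E X} f e he => ?_⟩
    obtain ⟨g, hg⟩ := Module.projective_lifting_property e.hom.hom f.hom.hom
      ((fgModuleCat_epi_iff_surjective e).mp he)
    exact ⟨FGModuleCat.ofHom g, by ext x; exact LinearMap.congr_fun hg x⟩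

instance : EnoughProjectives (FGModuleCat.{u} R) where
  presentation X := by
    obtain ⟨k, r, hr⟩ := Module.Finite.exists_fin' R X
    exact ⟨{
      p := FGModuleCat.of R (Fin k → R)
      projective := (fgModuleCat_projective_iff _).mpr
        (inferInstanceAs (Module.Projective R (Fin k → R)))
      f := (FGModuleCat.ofHom r : FGModuleCat.of R (Fin k → R) ⟶ FGModuleCat.of R X)
      epi := (fgModuleCat_epi_iff_surjective _).mpr hr }⟩

lemma fgModuleCat_addObj_of_projective (P : FGModuleCat.{u} R) [Projective P] :
    addObj (FGModuleCat.of R R) P := by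
  obtain ⟨k, x, hx⟩ := Module.Finite.exists_fin (R := R) (M := P)
  let π : ⨁ (fun _ : Fin k => FGModuleCat.of R R) ⟶ P :=
    biproduct.desc fun j => FGModuleCat.ofHom (LinearMap.toSpanSingleton R P (x j))
  have hπ (j : Fin k) : x j ∈ LinearMap.range π.hom.hom := by
    refine ⟨(biproduct.ι (fun _ : Fin k => FGModuleCat.of R R) j).hom.hom (1 : R), ?_⟩
    have hj : biproduct.ι (fun _ : Fin k => FGModuleCat.of R R) j ≫ π = _ := biproduct.ι_desc _ j
    exact (congrArg (fun f : FGModuleCat.of R R ⟶ P => f.hom.hom (1 : R)) hj).trans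
      (one_smul R (x j))
  have : Epi π := by
    rw [fgModuleCat_epi_iff_surjective, ← LinearMap.range_eq_top, eq_top_iff, ← hx,
      Submodule.span_le]
    rintro _ ⟨j, rfl⟩
    exact hπ j
  exact ⟨k, fun _ => FGModuleCat.of R R, fun _ => by simp,
    ⟨⟨Projective.factorThru (𝟙 P) π, π, Projective.factorThru_comp _ _⟩⟩⟩

variable (f : R →+* S)
  (hf : Module.Finite R ((ModuleCat.restrictScalars f).obj (ModuleCat.of S S)))

/-- Restriction of scalars between categories of finitely generated modules, along a ring
homomorphism `f : R →+* S` for which `S` is finitely generated over `R`. -/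
noncomputable def restrictScalarsFG : FGModuleCat.{u} S ⥤ FGModuleCat.{u} R :=
  ObjectProperty.lift _ (ObjectProperty.ι _ ⋙ ModuleCat.restrictScalars f) fun X => by
    let : Module R S := Module.compHom S f
    let : Module R X.obj := Module.compHom X.obj f
    have : IsScalarTower R S X.obj := ⟨fun r s x => mul_smul (f r) s x⟩
    have : Module.Finite R S := hf
    exact Module.Finite.trans (R := R) S X.obj

instance : (restrictScalarsFG f hf).Additive where
  map_add := rfl

lemma restrictScalarsFG_exact : PreservesFiniteLimits (restrictScalarsFG f hf) ∧
    PreservesFiniteColimits (restrictScalarsFG f hf) :=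
  preservesFiniteLimits_and_colimits_of_shortExact _ fun T hT =>
    (fgModuleCat_shortExact_iff _).mpr ((fgModuleCat_shortExact_iff T).mp hT)

instance : PreservesFiniteLimits (restrictScalarsFG f hf) := (restrictScalarsFG_exact f hf).1

instance : PreservesFiniteColimits (restrictScalarsFG f hf) := (restrictScalarsFG_exact f hf).2

lemma restrictScalarsFG_projective
    [hS : Module.Projective R ((ModuleCat.restrictScalars f).obj (ModuleCat.of S S))]
    (P : FGModuleCat.{u} S) (hP : Projective P) : Projective ((restrictScalarsFG f hf).obj P) := by
  rw [fgModuleCat_projective_iff] at hP ⊢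
  let : Module R S := Module.compHom S f
  let : Module R P := Module.compHom P f
  have : IsScalarTower R S P := ⟨fun r s x => mul_smul (f r) s x⟩
  have : IsScalarTower R S S := ⟨fun r s x => mul_assoc (f r) s x⟩
  have : Module.Projective R S := hS
  exact module_projective_trans (R := R) (S := S) (X := P)

end FGModules

namespace BalancedTensor

section Lift

variable {Γ : Type u} [Ring Γ] {X N : Type u} [AddCommGroup X] [Module Γᵐᵒᵖ X]
  [AddCommGroup N] [Module Γ N]

/-- The universal property of `X ⊗_Γ N`: the homomorphism `x ⊗ n ↦ f x n` attached to a balanced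
biadditive map `f`. -/
def lift {P : Type*} [AddCommGroup P] (f : X →+ N →+ P)
    (hf : ∀ (x : X) (γ : Γ) (n : N), f (op γ • x) n = f x (γ • n)) :
    BalancedTensor Γ X N →+ P :=
  QuotientAddGroup.lift (balancedRelations Γ X N)
    (TensorProduct.liftAddHom (R := ℤ) f fun r x n => by simp) (by
      rw [balancedRelations, AddSubgroup.closure_le]
      rintro _ ⟨x, γ, n, rfl⟩
      change TensorProduct.liftAddHom (R := ℤ) f _ _ = 0
      simp [hf])

lemma hom_ext {P : Type*} [AddCommGroup P] {f g : BalancedTensor Γ X N →+ P}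
    (h : ∀ x n, f (tmul Γ x n) = g (tmul Γ x n)) : f = g := by
  ext t
  induction t using induction_on with
  | zero => rw [map_zero, map_zero]
  | tmul x n => exact h x n
  | add a b ha hb => rw [map_add, map_add, ha, hb]

end Lift

section Exactness

variable {Γ : Type u} [Ring Γ] {X X' X'' N : Type u} [AddCommGroup X] [Module Γᵐᵒᵖ X]
  [AddCommGroup X'] [Module Γᵐᵒᵖ X'] [AddCommGroup X''] [Module Γᵐᵒᵖ X'']
  [AddCommGroup N] [Module Γ N]

lemma map_surjective {f : X →ₗ[Γᵐᵒᵖ] X'} (hf : Function.Surjective f) :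
    Function.Surjective (map Γ f (LinearMap.id : N →ₗ[Γ] N)) := by
  intro t
  induction t using induction_on with
  | zero => exact ⟨0, map_zero _⟩
  | tmul x n =>
    obtain ⟨y, rfl⟩ := hf x
    exact ⟨tmul Γ y n, rfl⟩
  | add a b ha hb =>
    obtain ⟨a', rfl⟩ := ha
    obtain ⟨b', rfl⟩ := hb
    exact ⟨a' + b', map_add _ _ _⟩

variable {ι : Type*}

variable (X) in
/-- The coordinates `x ⊗ n ↦ (x s(n)ᵢ)ᵢ` of a tensor, for `s` a homomorphism from `N` to a free
module. -/
noncomputable def coordinates (s : N →ₗ[Γ] (ι →₀ Γ)) : BalancedTensor Γ X N →+ (ι →₀ X) :=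
  lift (AddMonoidHom.mk' (fun x => (Finsupp.mapRange.addMonoidHom
      (AddMonoidHom.mk' (fun γ : Γ => op γ • x) fun a b => by
        rw [MulOpposite.op_add, add_smul])).comp s.toAddMonoidHom) fun x y => by
      ext n i
      exact smul_add _ _ _)
    fun x γ n => by
      ext i
      change op (s n i) • op γ • x = op (s (γ • n) i) • x
      rw [map_smul, Finsupp.smul_apply, smul_eq_mul, op_mul, mul_smul]

variable (Γ X) in
/-- The tensor `∑ᵢ xᵢ ⊗ bᵢ` with prescribed coordinates. -/
noncomputable def ofCoordinates (b : ι → N) : (ι →₀ X) →+ BalancedTensor Γ X N :=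
  Finsupp.liftAddHom fun i => AddMonoidHom.mk' (fun x => tmul Γ x (b i)) fun _ _ => add_tmul Γ _ _ _

lemma ofCoordinates_single (b : ι → N) (i : ι) (x : X) :
    ofCoordinates Γ X b (Finsupp.single i x) = tmul Γ x (b i) :=
  Finsupp.liftAddHom_apply_single _ _ _

lemma ofCoordinates_coordinates {s : N →ₗ[Γ] (ι →₀ Γ)} {b : ι → N}
    (h : Finsupp.linearCombination Γ b ∘ₗ s = LinearMap.id) (t : BalancedTensor Γ X N) :
    ofCoordinates Γ X b (coordinates X s t) = t := by
  have key (x : X) (c : ι →₀ Γ) :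
      ofCoordinates Γ X b
          (c.mapRange (fun γ => op γ • x) (by rw [MulOpposite.op_zero, zero_smul])) =
        tmul Γ x (Finsupp.linearCombination Γ b c) := by
    induction c using Finsupp.induction_linear with
    | zero => rw [Finsupp.mapRange_zero, map_zero, map_zero, tmul_zero]
    | add c d hc hd =>
      rw [Finsupp.mapRange_add fun γ δ => by rw [MulOpposite.op_add, add_smul], map_add, hc, hd,
        map_add, tmul_add]
    | single i γ =>
      rw [Finsupp.mapRange_single, ofCoordinates_single, smul_tmul,
        Finsupp.linearCombination_single]
  induction t using induction_on with
  | zero => rw [map_zero, map_zero]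
  | tmul x n => exact (key x (s n)).trans (congrArg (tmul Γ x) (LinearMap.congr_fun h n))
  | add a b ha hb => rw [map_add, map_add, ha, hb]

lemma coordinates_map (s : N →ₗ[Γ] (ι →₀ Γ)) (f : X →ₗ[Γᵐᵒᵖ] X') (t : BalancedTensor Γ X N) :
    coordinates X' s (map Γ f LinearMap.id t) =
      Finsupp.mapRange.addMonoidHom f.toAddMonoidHom (coordinates X s t) := by
  refine DFunLike.congr_fun (f := (coordinates X' s).comp (map Γ f LinearMap.id))
    (g := (Finsupp.mapRange.addMonoidHom f.toAddMonoidHom).comp (coordinates X s))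
    (hom_ext fun x n => ?_) t
  ext i
  exact (f.map_smul _ _).symm

lemma map_ofCoordinates (b : ι → N) (f : X →ₗ[Γᵐᵒᵖ] X') (c : ι →₀ X) :
    map Γ f LinearMap.id (ofCoordinates Γ X b c) =
      ofCoordinates Γ X' b (Finsupp.mapRange.addMonoidHom f.toAddMonoidHom c) := by
  induction c using Finsupp.induction_linear with
  | zero => simp only [map_zero]
  | add c d hc hd => simp only [map_add, hc, hd]
  | single i x =>
    rw [Finsupp.mapRange.addMonoidHom_apply, Finsupp.mapRange_single, ofCoordinates_single,
      ofCoordinates_single]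
    rfl

lemma map_injective [Module.Projective Γ N] {f : X →ₗ[Γᵐᵒᵖ] X'} (hf : Function.Injective f) :
    Function.Injective (map Γ f (LinearMap.id : N →ₗ[Γ] N)) := by
  obtain ⟨s, hs⟩ := Module.projective_def'.mp (inferInstance : Module.Projective Γ N)
  intro t t' h
  rw [← ofCoordinates_coordinates hs t, ← ofCoordinates_coordinates hs t']
  refine congrArg _ (Finsupp.mapRange_injective f f.map_zero hf ?_)
  exact (coordinates_map s f t).symm.trans ((congrArg _ h).trans (coordinates_map s f t'))

lemma map_exact [Module.Projective Γ N] {f : X →ₗ[Γᵐᵒᵖ] X'} {g : X' →ₗ[Γᵐᵒᵖ] X''}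
    (hfg : Function.Exact f g) :
    Function.Exact (map Γ f (LinearMap.id : N →ₗ[Γ] N)) (map Γ g (LinearMap.id : N →ₗ[Γ] N)) := by
  obtain ⟨s, hs⟩ := Module.projective_def'.mp (inferInstance : Module.Projective Γ N)
  refine fun t => ⟨fun ht => ?_, ?_⟩
  · have hg (i : N) : g (coordinates X' s t i) = 0 := by
      have h := coordinates_map s g t
      rw [ht, map_zero] at h
      exact (DFunLike.congr_fun h i).symm
    obtain ⟨y, hy⟩ : coordinates X' s t ∈ Set.range (Finsupp.mapRange f f.map_zero) := by
      rw [Finsupp.range_mapRange]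
      exact fun i => (hfg _).mp (hg i)
    refine ⟨ofCoordinates Γ X id y, (map_ofCoordinates id f y).trans ?_⟩
    exact (congrArg _ hy).trans (ofCoordinates_coordinates hs t)
  · rintro ⟨t, rfl⟩
    induction t using induction_on with
    | zero => rw [map_zero, map_zero]
    | tmul x n => rw [map_tmul, map_tmul, hfg.apply_apply_eq_zero, zero_tmul]
    | add a b ha hb => rw [map_add, map_add, ha, hb, add_zero]

end Exactness

section Bimodule

variable {Γ : Type u} [Ring Γ] {L : Type u} [Ring L] {X X' N : Type u}
  [AddCommGroup X] [Module Γᵐᵒᵖ X] [AddCommGroup X'] [Module Γᵐᵒᵖ X']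
  [AddCommGroup N] [Module Γ N] [Module Lᵐᵒᵖ N] [SMulCommClass Γ Lᵐᵒᵖ N]

instance : SMul Lᵐᵒᵖ (BalancedTensor Γ X N) where
  smul l :=
    haveI := SMulCommClass.symm Γ Lᵐᵒᵖ N
    map Γ LinearMap.id (Module.toModuleEnd Γ (S := Lᵐᵒᵖ) N l)

lemma right_smul_tmul (l : Lᵐᵒᵖ) (x : X) (n : N) : l • tmul Γ x n = tmul Γ x (l • n) := rfl

instance : DistribSMul Lᵐᵒᵖ (BalancedTensor Γ X N) where
  smul_zero l :=
    haveI := SMulCommClass.symm Γ Lᵐᵒᵖ N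
    map_zero (map Γ (LinearMap.id (M := X)) (Module.toModuleEnd Γ (S := Lᵐᵒᵖ) N l))
  smul_add l :=
    haveI := SMulCommClass.symm Γ Lᵐᵒᵖ N
    map_add (map Γ (LinearMap.id (M := X)) (Module.toModuleEnd Γ (S := Lᵐᵒᵖ) N l))

instance : Module Lᵐᵒᵖ (BalancedTensor Γ X N) where
  one_smul t := by
    induction t using induction_on with
    | zero => exact smul_zero _
    | tmul x n => rw [right_smul_tmul, one_smul]
    | add a b ha hb => rw [smul_add, ha, hb]
  mul_smul k l t := by
    induction t using induction_on with
    | zero => simp only [smul_zero]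
    | tmul x n => simp only [right_smul_tmul, mul_smul]
    | add a b ha hb => simp only [smul_add, ha, hb]
  smul_zero := smul_zero
  smul_add := smul_add
  add_smul k l t := by
    induction t using induction_on with
    | zero => simp only [smul_zero, add_zero]
    | tmul x n => simp only [right_smul_tmul, add_smul, tmul_add]
    | add a b ha hb => simp only [smul_add, ha, hb]; abel
  zero_smul t := by
    induction t using induction_on with
    | zero => exact smul_zero _
    | tmul x n => rw [right_smul_tmul, zero_smul, tmul_zero]
    | add a b ha hb => rw [smul_add, ha, hb, add_zero]

lemma linearMap_ext {P : Type*} [AddCommGroup P] [Module Lᵐᵒᵖ P]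
    {f g : BalancedTensor Γ X N →ₗ[Lᵐᵒᵖ] P}
    (h : ∀ x n, f (tmul Γ x n) = g (tmul Γ x n)) : f = g :=
  LinearMap.toAddMonoidHom_injective (hom_ext h)

variable (Γ L N) in
/-- The right linear map `n ↦ x ⊗ n`. -/
def mk (x : X) : N →ₗ[Lᵐᵒᵖ] BalancedTensor Γ X N where
  toFun := tmul Γ x
  map_add' := tmul_add Γ x
  map_smul' _ _ := rfl

/-- The right linear map `x ⊗ n ↦ f x n` attached to a balanced map `f` which is right linear in
the second variable. -/
def liftLinear {P : Type*} [AddCommGroup P] [Module Lᵐᵒᵖ P] (f : X →+ (N →ₗ[Lᵐᵒᵖ] P))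
    (hf : ∀ (x : X) (γ : Γ) (n : N), f (op γ • x) n = f x (γ • n)) :
    BalancedTensor Γ X N →ₗ[Lᵐᵒᵖ] P where
  __ := lift (AddMonoidHom.mk' (fun x => (f x).toAddMonoidHom) fun x y => by rw [map_add]; rfl) hf
  map_smul' l t := by
    change lift _ hf (l • t) = l • lift _ hf t
    induction t using induction_on with
    | zero => rw [smul_zero, map_zero, smul_zero]
    | tmul x n => exact (f x).map_smul l n
    | add a b ha hb => rw [smul_add, map_add, map_add, smul_add, ha, hb]

variable (L N) in
/-- The right linear map `f ⊗ N`. -/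
def mapLinear (f : X →ₗ[Γᵐᵒᵖ] X') : BalancedTensor Γ X N →ₗ[Lᵐᵒᵖ] BalancedTensor Γ X' N where
  __ := map Γ f LinearMap.id
  map_smul' l t := by
    change map Γ f LinearMap.id (l • t) = l • map Γ f LinearMap.id t
    induction t using induction_on with
    | zero => rw [smul_zero, map_zero, smul_zero]
    | tmul x n => rfl
    | add a b ha hb => rw [smul_add, map_add, map_add, smul_add, ha, hb]

variable (Γ X) in
lemma subsingleton_of_right [Subsingleton N] : Subsingleton (BalancedTensor Γ X N) := by
  refine subsingleton_of_forall_eq 0 fun t => ?_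
  induction t using induction_on with
  | zero => rfl
  | tmul x n => rw [Subsingleton.elim n 0, tmul_zero]
  | add a b ha hb => rw [ha, hb, add_zero]

instance finite [Module.Finite Γᵐᵒᵖ X] [Module.Finite Lᵐᵒᵖ N] :
    Module.Finite Lᵐᵒᵖ (BalancedTensor Γ X N) := by
  obtain ⟨k, x, hx⟩ := Module.Finite.exists_fin (R := Γᵐᵒᵖ) (M := X)
  let p : (Fin k → N) →ₗ[Lᵐᵒᵖ] BalancedTensor Γ X N :=
    ∑ i, mk Γ L N (x i) ∘ₗ LinearMap.proj i
  have hp (y : Fin k → N) : p y = ∑ i, tmul Γ (x i) (y i) := by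
    rw [LinearMap.sum_apply]
    rfl
  refine .of_surjective p fun t => ?_
  induction t using induction_on with
  | zero => exact ⟨0, map_zero p⟩
  | tmul y n =>
    obtain ⟨c, rfl⟩ := (Submodule.mem_span_range_iff_exists_fun Γᵐᵒᵖ).mp
      (hx ▸ Submodule.mem_top : y ∈ Submodule.span Γᵐᵒᵖ (Set.range x))
    refine ⟨fun i => (c i).unop • n, (hp _).trans ?_⟩
    simp_rw [← smul_tmul, op_unop]
    exact (map_sum (AddMonoidHom.mk' (fun z => tmul Γ z n) fun _ _ => add_tmul Γ _ _ _) _ _).symm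
  | add a b ha hb =>
    obtain ⟨a', rfl⟩ := ha
    obtain ⟨b', rfl⟩ := hb
    exact ⟨a' + b', map_add p _ _⟩

variable (Γ L N) in
lemma projective_self_left [Module.Projective Lᵐᵒᵖ N] :
    Module.Projective Lᵐᵒᵖ (BalancedTensor Γ Γᵐᵒᵖ N) := by
  have := SMulCommClass.symm Γ Lᵐᵒᵖ N
  let p : BalancedTensor Γ Γᵐᵒᵖ N →ₗ[Lᵐᵒᵖ] N :=
    liftLinear ((Module.toModuleEnd Lᵐᵒᵖ (S := Γ) N).toAddMonoidHom.comp
      (opAddEquiv (α := Γ)).symm.toAddMonoidHom) fun γ δ n => mul_smul γ.unop δ n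
  refine .of_split p (mk Γ L N 1) (linearMap_ext fun γ n => ?_)
  change tmul Γ 1 (γ.unop • n) = tmul Γ γ n
  rw [← smul_tmul, op_unop, smul_eq_mul, mul_one]

end Bimodule

section Assoc

variable {Γ : Type u} [Ring Γ] {X M N : Type u} [AddCommGroup X] [Module Γᵐᵒᵖ X]
  [AddCommGroup M] [Module Γ M] [Module Γᵐᵒᵖ M] [SMulCommClass Γ Γᵐᵒᵖ M]
  [AddCommGroup N] [Module Γ N]

variable (X M N) in
/-- The homomorphism `x ⊗ (m ⊗ n) ↦ (x ⊗ m) ⊗ n`. -/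
def assocInv :
    BalancedTensor Γ X (BalancedTensor Γ M N) →+ BalancedTensor Γ (BalancedTensor Γ X M) N :=
  lift (AddMonoidHom.mk' (fun x => map Γ (mk Γ Γ M x) (LinearMap.id : N →ₗ[Γ] N)) fun x y =>
      hom_ext fun m n => (congrArg (tmul Γ · n) (add_tmul Γ x y m)).trans (add_tmul Γ _ _ n))
    fun x γ t => by
      induction t using induction_on with
      | zero => rw [smul_zero, map_zero, map_zero]
      | tmul m n => exact congrArg (tmul Γ · n) (smul_tmul Γ x γ m)
      | add a b ha hb => rw [smul_add, map_add, map_add, ha, hb]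

lemma assocInv_surjective : Function.Surjective (assocInv (Γ := Γ) X M N) := by
  intro t
  induction t using induction_on with
  | zero => exact ⟨0, map_zero _⟩
  | tmul s n =>
    induction s using induction_on with
    | zero => exact ⟨0, by rw [zero_tmul, map_zero]⟩
    | tmul x m => exact ⟨tmul Γ x (tmul Γ m n), rfl⟩
    | add a b ha hb =>
      obtain ⟨a', ha⟩ := ha
      obtain ⟨b', hb⟩ := hb
      exact ⟨a' + b', by rw [map_add, add_tmul, ha, hb]⟩
  | add a b ha hb =>
    obtain ⟨a', rfl⟩ := ha
    obtain ⟨b', rfl⟩ := hb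
    exact ⟨a' + b', map_add _ _ _⟩

end Assoc

section TensorFunctor

variable (Γ L : Type u) [Ring Γ] [Ring L] (N : Type u) [AddCommGroup N] [Module Γ N]
  [Module Lᵐᵒᵖ N] [SMulCommClass Γ Lᵐᵒᵖ N] [Module.Finite Lᵐᵒᵖ N]

/-- The functor `– ⊗_Γ N` between finitely generated right modules attached to a `Γ`-`L`-bimodule
`N`, finitely generated on the right. -/
noncomputable def tensorFunctor : FGRightMod Γ ⥤ FGRightMod L where
  obj X := FGModuleCat.of _ (BalancedTensor Γ X N)
  map f := FGModuleCat.ofHom (mapLinear L N f.hom.hom)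
  map_id _ := InducedCategory.hom_ext (ModuleCat.hom_ext (linearMap_ext fun _ _ => rfl))
  map_comp _ _ := InducedCategory.hom_ext (ModuleCat.hom_ext (linearMap_ext fun _ _ => rfl))

instance : (tensorFunctor Γ L N).Additive where
  map_add := InducedCategory.hom_ext (ModuleCat.hom_ext (linearMap_ext fun _ _ =>
    add_tmul Γ _ _ _))

variable [IsNoetherianRing Γᵐᵒᵖ] [IsNoetherianRing Lᵐᵒᵖ]

lemma tensorFunctor_exact [Module.Projective Γ N] :
    PreservesFiniteLimits (tensorFunctor Γ L N) ∧
      PreservesFiniteColimits (tensorFunctor Γ L N) := by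
  refine preservesFiniteLimits_and_colimits_of_shortExact _ fun T hT => ?_
  obtain ⟨hinj, hexact, hsurj⟩ := (fgModuleCat_shortExact_iff T).mp hT
  exact (fgModuleCat_shortExact_iff _).mpr
    ⟨map_injective hinj, map_exact hexact, map_surjective hsurj⟩

instance [Module.Projective Γ N] : PreservesFiniteLimits (tensorFunctor Γ L N) :=
  (tensorFunctor_exact Γ L N).1

instance [Module.Projective Γ N] : PreservesFiniteColimits (tensorFunctor Γ L N) :=
  (tensorFunctor_exact Γ L N).2

attribute [local instance] Abelian.hasFiniteBiproducts in
lemma tensorFunctor_projective [Module.Projective Lᵐᵒᵖ N] (P : FGRightMod Γ) (hP : Projective P) :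
    Projective ((tensorFunctor Γ L N).obj P) := by
  have hΓ : Projective ((tensorFunctor Γ L N).obj (FGModuleCat.of Γᵐᵒᵖ Γᵐᵒᵖ)) :=
    (fgModuleCat_projective_iff _).mpr (projective_self_left Γ L N)
  obtain ⟨k, Q, hQ, ⟨r⟩⟩ := addClosure_map (V := isProjective (FGRightMod L))
    (tensorFunctor Γ L N) (fun X hX => by
      rw [ObjectProperty.singleton_iff] at hX
      exact hX ▸ hΓ) (fgModuleCat_addObj_of_projective P)
  have (i : Fin k) : Projective (Q i) := hQ i
  have := projective_biproduct Q
  exact r.projective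

end TensorFunctor

end BalancedTensor

section OppositeSelf

instance module_finite_op_self (R : Type*) [Ring R] : Module.Finite Rᵐᵒᵖ R :=
  Module.Finite.equiv (opLinearEquiv Rᵐᵒᵖ).symm

instance module_projective_op_self (R : Type*) [Ring R] : Module.Projective Rᵐᵒᵖ R :=
  Module.Projective.of_equiv (opLinearEquiv Rᵐᵒᵖ).symm

end OppositeSelf

namespace ThetaExtension

open BalancedTensor (tmul)

variable {Γ : Type u} [Ring Γ] {M : Type u} [AddCommGroup M] [Module Γ M]
  [Module Γᵐᵒᵖ M] [SMulCommClass Γ Γᵐᵒᵖ M] (θ : AssocBimoduleHom Γ M)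

/-- The projection `(γ, m) ↦ γ`, a ring homomorphism split by `inl θ`. -/
def fstHom : ThetaExtension θ →+* Γ where
  toFun x := x.1
  map_one' := rfl
  map_zero' := rfl
  map_mul' _ _ := rfl
  map_add' _ _ := rfl

/-- The inclusion `m ↦ (0, m)` of the ideal `M`. -/
def inr : M →+ ThetaExtension θ where
  toFun m := ((0, m) : Γ × M)
  map_zero' := rfl
  map_add' _ _ := ThetaExtension.ext (add_zero (0 : Γ)).symm rfl

@[simp] lemma fst_inl (γ : Γ) : (inl θ γ).1 = γ := rfl
@[simp] lemma snd_inl (γ : Γ) : (inl θ γ).2 = 0 := rfl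
@[simp] lemma fst_inr (m : M) : (inr θ m).1 = 0 := rfl
@[simp] lemma snd_inr (m : M) : (inr θ m).2 = m := rfl

lemma eq_inl_add_inr (x : ThetaExtension θ) : x = inl θ x.1 + inr θ x.2 := by
  ext <;> simp

lemma inr_mul (m : M) (x : ThetaExtension θ) :
    inr θ m * x = inr θ (op x.1 • m + θ.toHom (tmul Γ m x.2)) := by
  ext <;> simp

lemma inr_mul_inl (γ : Γ) (m : M) : inr θ m * inl θ γ = inr θ (op γ • m) := by
  ext <;> simp [BalancedTensor.tmul_zero]

lemma inl_mul_inr (γ : Γ) (m : M) : inl θ γ * inr θ m = inr θ (γ • m) := by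
  ext <;> simp [BalancedTensor.zero_tmul]

lemma finite_fstHom : Module.Finite (ThetaExtension θ)ᵐᵒᵖ
    ((ModuleCat.restrictScalars (fstHom θ).op).obj (ModuleCat.of Γᵐᵒᵖ Γᵐᵒᵖ)) := by
  let e : (ThetaExtension θ)ᵐᵒᵖ →ₗ[(ThetaExtension θ)ᵐᵒᵖ]
      (ModuleCat.restrictScalars (fstHom θ).op).obj (ModuleCat.of Γᵐᵒᵖ Γᵐᵒᵖ) :=
    { toFun := (fstHom θ).op
      map_add' := map_add _
      map_smul' := map_mul (fstHom θ).op }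
  exact .of_surjective e fun γ => ⟨(inl θ).op γ, rfl⟩

/-- As a right `Γ`-module, `Γ ⋉_θ M` is `Γ × M`. -/
def rightEquiv : (Γᵐᵒᵖ × M) ≃ₗ[Γᵐᵒᵖ] (ModuleCat.restrictScalars (inl θ).op).obj
    (ModuleCat.of (ThetaExtension θ)ᵐᵒᵖ (ThetaExtension θ)ᵐᵒᵖ) where
  toFun p := op ((p.1.unop, p.2) : Γ × M)
  invFun x := (op x.unop.1, x.unop.2)
  left_inv _ := rfl
  right_inv _ := rfl
  map_add' _ _ := rfl
  map_smul' γ p := by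
    refine unop_injective (ThetaExtension.ext rfl ?_)
    change γ • p.2 = p.1.unop • (0 : M) + op γ.unop • p.2 + θ.toHom (tmul Γ p.2 (0 : M))
    rw [smul_zero, zero_add, BalancedTensor.tmul_zero, map_zero, add_zero, op_unop]

lemma finite_inl [Module.Finite Γᵐᵒᵖ M] : Module.Finite Γᵐᵒᵖ
    ((ModuleCat.restrictScalars (inl θ).op).obj
      (ModuleCat.of (ThetaExtension θ)ᵐᵒᵖ (ThetaExtension θ)ᵐᵒᵖ)) :=
  .equiv (rightEquiv θ)

lemma projective_inl [Module.Projective Γᵐᵒᵖ M] : Module.Projective Γᵐᵒᵖ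
    ((ModuleCat.restrictScalars (inl θ).op).obj
      (ModuleCat.of (ThetaExtension θ)ᵐᵒᵖ (ThetaExtension θ)ᵐᵒᵖ)) :=
  .of_equiv (rightEquiv θ)

section Functors

variable [IsNoetherianRing Γᵐᵒᵖ] [Module.Finite Γᵐᵒᵖ M]

/-- The functor `mod-Γ ⥤ mod-(Γ ⋉_θ M)` letting `M` act by zero. -/
noncomputable abbrev inflation : FGRightMod Γ ⥤ FGRightMod (ThetaExtension θ) :=
  restrictScalarsFG (fstHom θ).op (finite_fstHom θ)

/-- The restriction functor `mod-(Γ ⋉_θ M) ⥤ mod-Γ`. -/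
noncomputable abbrev restriction : FGRightMod (ThetaExtension θ) ⥤ FGRightMod Γ :=
  restrictScalarsFG (inl θ).op (finite_inl θ)

/-- Inflation followed by restriction is the identity, since `fstHom θ` is a retraction of
`inl θ`. -/
noncomputable def inflationCompRestriction : inflation θ ⋙ restriction θ ≅ 𝟭 (FGRightMod Γ) :=
  NatIso.ofComponents (fun X =>
    { hom := ObjectProperty.homMk (ModuleCat.ofHom
        (X := (restriction θ).obj ((inflation θ).obj X)) (Y := X)
        { toFun := id, map_add' := fun _ _ => rfl, map_smul' := fun _ _ => rfl })
      inv := ObjectProperty.homMk (ModuleCat.ofHom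
        (X := X) (Y := (restriction θ).obj ((inflation θ).obj X))
        { toFun := id, map_add' := fun _ _ => rfl, map_smul' := fun _ _ => rfl }) })
    fun _ => rfl

instance : (restriction θ).EssSurj where
  mem_essImage X := ⟨(inflation θ).obj X, ⟨(inflationCompRestriction θ).app X⟩⟩

lemma restriction_projective [Module.Projective Γᵐᵒᵖ M] (P : FGRightMod (ThetaExtension θ))
    (hP : Projective P) : Projective ((restriction θ).obj P) :=
  have := projective_inl θ
  restrictScalarsFG_projective _ _ P hP

end Functors

variable {θ}

section LeftModule

/-- The left `Γ`-module structure of `Γ ⋉_θ M`. -/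
abbrev leftModule : Module Γ (ThetaExtension θ) := Module.compHom _ (inl θ)

attribute [local instance] leftModule

lemma smul_eq_inl_mul (γ : Γ) (l : ThetaExtension θ) : γ • l = inl θ γ * l := rfl

instance : SMulCommClass Γ (ThetaExtension θ)ᵐᵒᵖ (ThetaExtension θ) where
  smul_comm γ k l := (mul_assoc (inl θ γ) l k.unop).symm

/-- As a left `Γ`-module, `Γ ⋉_θ M` is `Γ × M`. -/
def leftEquiv : (Γ × M) ≃ₗ[Γ] ThetaExtension θ where
  toFun p := p
  invFun l := l
  left_inv _ := rfl
  right_inv _ := rfl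
  map_add' _ _ := rfl
  map_smul' γ p := by
    refine ThetaExtension.ext rfl ?_
    change γ • p.2 = γ • p.2 + op p.1 • (0 : M) + θ.toHom (tmul Γ (0 : M) p.2)
    rw [smul_zero, add_zero, BalancedTensor.zero_tmul, map_zero, add_zero]

instance projective_left [Module.Projective Γ M] : Module.Projective Γ (ThetaExtension θ) :=
  .of_equiv leftEquiv

variable (θ) in
/-- `inr θ` as a homomorphism of left `Γ`-modules. -/
def inrLinear : M →ₗ[Γ] ThetaExtension θ where
  __ := inr θ
  map_smul' γ m := (inl_mul_inr θ γ m).symm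

end LeftModule

/-- The right `Γ`-module underlying a right module over `Γ ⋉_θ M`. -/
noncomputable abbrev restrictedModule (X : FGRightMod (ThetaExtension θ)) : Module Γᵐᵒᵖ X :=
  Module.compHom X (inl θ).op

attribute [local instance] leftModule restrictedModule

section Nilpotence

variable (E : FGRightMod (ThetaExtension θ) → FGRightMod (ThetaExtension θ))
  (hE : ∀ X : FGRightMod (ThetaExtension θ),
    ∃ g : BalancedTensor Γ X M →ₗ[Γᵐᵒᵖ] E X, Function.Surjective g)

include hE

lemma isZero_iterate_of_subsingleton_tensor (j : ℕ) (X : FGRightMod (ThetaExtension θ))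
    (h : Subsingleton (BalancedTensor Γ X (BimodulePower Γ M (j + 1)))) :
    IsZero (E^[j + 1] X) := by
  induction j generalizing X with
  | zero =>
    obtain ⟨g, hg⟩ := hE X
    have : Subsingleton (BalancedTensor Γ X M) := h
    exact (fgModuleCat_isZero_iff_subsingleton _).mpr hg.subsingleton
  | succ j ih =>
    obtain ⟨g, hg⟩ := hE X
    have : Subsingleton (BalancedTensor Γ X (BalancedTensor Γ M (BimodulePower Γ M (j + 1)))) := h
    have : Subsingleton (BalancedTensor Γ (BalancedTensor Γ X M) (BimodulePower Γ M (j + 1))) :=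
      BalancedTensor.assocInv_surjective.subsingleton
    exact ih (E X) (BalancedTensor.map_surjective hg).subsingleton

lemma isZero_iterate {n : ℕ} (hn : 0 < n) (hM : Subsingleton (BimodulePower Γ M n))
    (X : FGRightMod (ThetaExtension θ)) : IsZero (E^[n] X) := by
  obtain ⟨n, rfl⟩ := Nat.exists_eq_add_of_le' hn
  exact isZero_iterate_of_subsingleton_tensor E hE n X (BalancedTensor.subsingleton_of_right Γ X)

end Nilpotence

section Counit

variable (X : FGRightMod (ThetaExtension θ))

/-- The counit `X ⊗_Γ (Γ ⋉_θ M) → X`, `x ⊗ l ↦ x l`. -/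
noncomputable def counit :
    BalancedTensor Γ X (ThetaExtension θ) →ₗ[(ThetaExtension θ)ᵐᵒᵖ] X :=
  BalancedTensor.liftLinear (AddMonoidHom.mk' (fun x =>
      LinearMap.toSpanSingleton _ X x ∘ₗ (opLinearEquiv (ThetaExtension θ)ᵐᵒᵖ).toLinearMap)
      fun x y => LinearMap.ext fun l => smul_add (op l) x y)
    fun x γ l => (mul_smul (op l) (op (inl θ γ)) x).symm

lemma counit_tmul_one (x : X) : counit X (tmul Γ x 1) = x := one_smul _ x

/-- The homomorphism `X ⊗_Γ M → X ⊗_Γ (Γ ⋉_θ M)` induced by the inclusion of `M`. -/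
noncomputable def tensorInr : BalancedTensor Γ X M →+ BalancedTensor Γ X (ThetaExtension θ) :=
  BalancedTensor.map Γ LinearMap.id (inrLinear θ)

lemma tensorInr_tmul (x : X) (m : M) : tensorInr X (tmul Γ x m) = tmul Γ x (inr θ m) := rfl

lemma tensorInr_smul (γ : Γᵐᵒᵖ) (t : BalancedTensor Γ X M) :
    tensorInr X (γ • t) = op (inl θ γ.unop) • tensorInr X t := by
  induction t using BalancedTensor.induction_on with
  | zero => rw [smul_zero, map_zero, smul_zero]
  | tmul x m => exact congrArg (tmul Γ x) (inr_mul_inl θ γ.unop m).symm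
  | add a b ha hb => rw [smul_add, map_add, map_add, smul_add, ha, hb]

lemma tmul_smul_one (γ : Γᵐᵒᵖ) (x : X) : tmul Γ (γ • x) (1 : ThetaExtension θ) =
    op (inl θ γ.unop) • tmul Γ x (1 : ThetaExtension θ) := by
  rw [BalancedTensor.right_smul_tmul, op_smul_eq_mul, one_mul, ← op_unop γ,
    BalancedTensor.smul_tmul, smul_eq_inl_mul, mul_one, op_unop]

lemma exists_eq_tensorInr_add (t : BalancedTensor Γ X (ThetaExtension θ)) :
    ∃ s x, t = tensorInr X s + tmul Γ x 1 := by
  induction t using BalancedTensor.induction_on with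
  | zero => exact ⟨0, 0, by rw [map_zero, BalancedTensor.zero_tmul, add_zero]⟩
  | tmul x l =>
    refine ⟨tmul Γ x l.2, op l.1 • x, ?_⟩
    conv_lhs => rw [eq_inl_add_inr θ l, BalancedTensor.tmul_add]
    rw [tensorInr_tmul, BalancedTensor.smul_tmul, smul_eq_inl_mul, mul_one, add_comm]
  | add a b ha hb =>
    obtain ⟨s, x, rfl⟩ := ha
    obtain ⟨s', x', rfl⟩ := hb
    exact ⟨s + s', x + x', by rw [map_add, BalancedTensor.add_tmul, add_add_add_comm]⟩

/-- The action map `X ⊗_Γ M → X`, `x ⊗ m ↦ x m`. -/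
noncomputable def act : BalancedTensor Γ X M →ₗ[Γᵐᵒᵖ] X where
  __ := (counit X).toAddMonoidHom.comp (tensorInr X)
  map_smul' γ t := (congrArg (counit X) (tensorInr_smul X γ t)).trans ((counit X).map_smul _ _)

lemma act_tmul (x : X) (m : M) : act X (tmul Γ x m) = op (inr θ m) • x := rfl

end Counit

section KernelCounit

variable [IsNoetherianRing Γᵐᵒᵖ] [Module.Finite Γᵐᵒᵖ M]

instance finite_restricted (X : FGRightMod (ThetaExtension θ)) : Module.Finite Γᵐᵒᵖ X :=
  ((restriction θ).obj X).property

/-- The kernel of the counit `X ⊗_Γ (Γ ⋉_θ M) → X`. -/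
noncomputable def kernelCounit (X : FGRightMod (ThetaExtension θ)) :
    FGRightMod (ThetaExtension θ) :=
  FGModuleCat.of _ (LinearMap.ker (counit X))

/-- Induction `– ⊗_Γ (Γ ⋉_θ M)` from right `Γ`-modules to right modules over `Γ ⋉_θ M`. -/
noncomputable abbrev inductionFunctor (θ : AssocBimoduleHom Γ M) :
    FGRightMod Γ ⥤ FGRightMod (ThetaExtension θ) :=
  BalancedTensor.tensorFunctor Γ (ThetaExtension θ) (ThetaExtension θ)

lemma inductionFunctor_projective (P : FGRightMod Γ) (hP : Projective P) :
    Projective ((inductionFunctor θ).obj P) :=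
  BalancedTensor.tensorFunctor_projective Γ _ _ P hP

lemma isExtension_kernelCounit (X : FGRightMod (ThetaExtension θ)) :
    IsExtension (kernelCounit X) ((inductionFunctor θ).obj ((restriction θ).obj X)) X :=
  isExtension_of_linearMap (X := kernelCounit X)
    (Y := (inductionFunctor θ).obj ((restriction θ).obj X))
    (LinearMap.ker (counit X)).subtype (counit X) Subtype.val_injective
    (LinearMap.exact_subtype_ker_map _) fun x => ⟨_, counit_tmul_one X x⟩

/-- The homomorphism `X ⊗_Γ M → ker (X ⊗_Γ (Γ ⋉_θ M) → X)`, `x ⊗ m ↦ x ⊗ m - x m ⊗ 1`. -/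
noncomputable def toKernelCounit (X : FGRightMod (ThetaExtension θ)) :
    BalancedTensor Γ X M →ₗ[Γᵐᵒᵖ] kernelCounit X where
  toFun t := ⟨tensorInr X t - tmul Γ (act X t) 1, by
    rw [LinearMap.mem_ker, map_sub, counit_tmul_one]
    exact sub_self _⟩
  map_add' s t := Subtype.ext <| by
    change tensorInr X (s + t) - tmul Γ (act X (s + t)) 1 =
      (tensorInr X s - tmul Γ (act X s) 1) + (tensorInr X t - tmul Γ (act X t) 1)
    rw [map_add, map_add, BalancedTensor.add_tmul, add_sub_add_comm]
  map_smul' γ t := Subtype.ext <| by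
    change tensorInr X (γ • t) - tmul Γ (act X (γ • t)) 1 =
      op (inl θ γ.unop) • (tensorInr X t - tmul Γ (act X t) 1)
    rw [tensorInr_smul, map_smul, tmul_smul_one, smul_sub]

lemma toKernelCounit_surjective (X : FGRightMod (ThetaExtension θ)) :
    Function.Surjective (toKernelCounit X) := by
  rintro ⟨t, ht⟩
  obtain ⟨s, x, rfl⟩ := exists_eq_tensorInr_add X t
  rw [LinearMap.mem_ker, map_add, counit_tmul_one] at ht
  have hx : x = -act X s := eq_neg_of_add_eq_zero_right ht
  refine ⟨s, Subtype.ext ?_⟩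
  change tensorInr X s - tmul Γ (act X s) 1 = tensorInr X s + tmul Γ x 1
  rw [sub_eq_iff_eq_add, add_assoc, ← BalancedTensor.add_tmul, hx, neg_add_cancel,
    BalancedTensor.zero_tmul, add_zero]

lemma isZero_kernelCounit_iterate {n : ℕ} (hn : 0 < n)
    (hM : Subsingleton (BimodulePower Γ M n)) (X : FGRightMod (ThetaExtension θ)) :
    IsZero (kernelCounit^[n] X) :=
  isZero_iterate _ (fun X => ⟨toKernelCounit X, toKernelCounit_surjective X⟩) hn hM X

end KernelCounit

/-- The submodule `X M` of `X`. -/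
noncomputable def actImage (X : FGRightMod (ThetaExtension θ)) :
    Submodule (ThetaExtension θ)ᵐᵒᵖ X where
  __ := (act X).toAddMonoidHom.range
  smul_mem' := by
    rintro l _ ⟨t, rfl⟩
    induction t using BalancedTensor.induction_on with
    | zero => exact ⟨0, ((map_zero _).trans (smul_zero l).symm).trans (by rw [map_zero])⟩
    | tmul x m =>
      refine ⟨tmul Γ x (op l.unop.1 • m + θ.toHom (tmul Γ m l.unop.2)), ?_⟩
      change op (inr θ _) • x = l • op (inr θ m) • x
      rw [← inr_mul, op_mul, mul_smul, op_unop]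
    | add a b ha hb =>
      obtain ⟨a', ha⟩ := ha
      obtain ⟨b', hb⟩ := hb
      exact ⟨a' + b', by rw [map_add, map_add, smul_add, ha, hb]⟩

lemma inr_smul_mem_actImage (X : FGRightMod (ThetaExtension θ)) (m : M) (x : X) :
    op (inr θ m) • x ∈ actImage X := ⟨tmul Γ x m, rfl⟩

lemma map_mem_actImage {X Y : FGRightMod (ThetaExtension θ)}
    (f : X →ₗ[(ThetaExtension θ)ᵐᵒᵖ] Y) {x : X} (hx : x ∈ actImage X) : f x ∈ actImage Y := by
  obtain ⟨t, rfl⟩ := hx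
  change f (act X t) ∈ actImage Y
  induction t using BalancedTensor.induction_on with
  | zero =>
    rw [map_zero, map_zero]
    exact zero_mem _
  | tmul x m =>
    rw [act_tmul, map_smul]
    exact inr_smul_mem_actImage Y m _
  | add a b ha hb =>
    rw [map_add, map_add]
    exact add_mem ha hb

section ActionFiltration

variable (θ) [IsNoetherianRing Γᵐᵒᵖ] [Module.Finite Γᵐᵒᵖ M]

/-- The functor `X ↦ X M`. -/
noncomputable def actImageFunctor :
    FGRightMod (ThetaExtension θ) ⥤ FGRightMod (ThetaExtension θ) where
  obj X := FGModuleCat.of _ (actImage X)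
  map f := FGModuleCat.ofHom (f.hom.hom.restrict fun _ => map_mem_actImage f.hom.hom)
  map_id _ := rfl
  map_comp _ _ := rfl

/-- The functor `X ↦ X / X M`, with values in modules over `Γ ⋉_θ M`. -/
noncomputable def actQuotientFunctor :
    FGRightMod (ThetaExtension θ) ⥤ FGRightMod (ThetaExtension θ) where
  obj X := FGModuleCat.of _ (X ⧸ actImage X)
  map f := FGModuleCat.ofHom ((actImage _).mapQ (actImage _) f.hom.hom
    fun _ => map_mem_actImage f.hom.hom)
  map_id X := InducedCategory.hom_ext (ModuleCat.hom_ext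
    (Submodule.linearMap_qext (actImage X) rfl))
  map_comp {X _ _} _ _ := InducedCategory.hom_ext (ModuleCat.hom_ext
    (Submodule.linearMap_qext (actImage X) rfl))

instance : (actImageFunctor θ).Additive where
  map_add := rfl

instance : (actQuotientFunctor θ).Additive where
  map_add {X _ _ _} := InducedCategory.hom_ext (ModuleCat.hom_ext
    (Submodule.linearMap_qext (actImage X) rfl))

/-- The inclusion of `X M` in `X`. -/
noncomputable def actImageι : actImageFunctor θ ⟶ 𝟭 (FGRightMod (ThetaExtension θ)) where
  app X := FGModuleCat.ofHom (actImage X).subtype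
  naturality _ _ _ := rfl

/-- The projection from `X` to `X / X M`, which is inflated from `Γ`. -/
noncomputable def actQuotientπ : 𝟭 (FGRightMod (ThetaExtension θ)) ⟶
    (actQuotientFunctor θ ⋙ restriction θ) ⋙ inflation θ where
  app X := ObjectProperty.homMk <| ModuleCat.ofHom (X := X)
    (Y := (inflation θ).obj ((restriction θ).obj ((actQuotientFunctor θ).obj X)))
    { toFun := (actImage X).mkQ
      map_add' := map_add _
      map_smul' := fun l x => by
        change (actImage X).mkQ (l • x) = op (inl θ l.unop.1) • (actImage X).mkQ x
        have hl : l = op (inl θ l.unop.1) + op (inr θ l.unop.2) :=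
          congrArg op (eq_inl_add_inr θ l.unop)
        have hx : (actImage X).mkQ (op (inr θ l.unop.2) • x) = 0 :=
          (Submodule.Quotient.mk_eq_zero _).mpr (inr_smul_mem_actImage X _ _)
        conv_lhs => rw [hl, add_smul, map_add, hx, add_zero, map_smul] }
  naturality _ _ _ := rfl

lemma actImageι_comp_actQuotientπ (X : FGRightMod (ThetaExtension θ)) :
    (actImageι θ).app X ≫ (actQuotientπ θ).app X = 0 := by
  ext x
  exact (Submodule.Quotient.mk_eq_zero _).mpr x.2

lemma shortExact_actImage_actQuotient (X : FGRightMod (ThetaExtension θ)) :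
    (ShortComplex.mk ((actImageι θ).app X) ((actQuotientπ θ).app X)
      (actImageι_comp_actQuotientπ θ X)).ShortExact := by
  rw [fgModuleCat_shortExact_iff]
  refine ⟨Subtype.val_injective, fun x => ?_, Submodule.mkQ_surjective _⟩
  refine (Submodule.Quotient.mk_eq_zero (actImage X)).trans ?_
  exact ⟨fun h => ⟨⟨x, h⟩, rfl⟩, fun ⟨y, h⟩ => h ▸ y.2⟩

lemma isZero_actImage_iterate {n : ℕ} (hn : 0 < n) (hM : Subsingleton (BimodulePower Γ M n))
    (X : FGRightMod (ThetaExtension θ)) : IsZero ((actImageFunctor θ).obj^[n] X) := by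
  refine isZero_iterate _ (fun X => ⟨?_, ?_⟩) hn hM X
  · exact
      { toFun := fun t => ⟨act X t, t, rfl⟩
        map_add' := fun s t => Subtype.ext (map_add (act X) s t)
        map_smul' := fun γ t => Subtype.ext (map_smul (act X) γ t) }
  · exact fun ⟨_, t, h⟩ => ⟨t, Subtype.ext h⟩

end ActionFiltration

end ThetaExtension

open ThetaExtension in
theorem mainTheorem6_general (Γ : Type u) [Ring Γ] [IsNoetherianRing Γᵐᵒᵖ]
    (M : Type u) [AddCommGroup M] [Module Γ M] [Module Γᵐᵒᵖ M] [SMulCommClass Γ Γᵐᵒᵖ M]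
    [Module.Finite Γᵐᵒᵖ M] (θ : AssocBimoduleHom Γ M)
    (n : ℕ) (hn : 0 < n) (hM : Subsingleton (BimodulePower Γ M n)) :
    ((Module.Projective Γᵐᵒᵖ M → ringIT Γ ≤ ringIT (ThetaExtension θ)) ∧
      (Module.Projective Γ M → ringIT (ThetaExtension θ) ≤ n * (ringIT Γ + 1) - 1)) ∧
    (ringExtDim Γ ≤ ringExtDim (ThetaExtension θ) ∧
      ringExtDim (ThetaExtension θ) ≤ n * (ringExtDim Γ + 1) - 1) ∧
    (ringDerDim Γ ≤ ringDerDim (ThetaExtension θ) ∧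
      ringDerDim (ThetaExtension θ) ≤ n * (ringDerDim Γ + 1) - 1) := by
  let := HasDerivedCategory.standard (FGRightMod Γ)
  let := HasDerivedCategory.standard (FGRightMod (ThetaExtension θ))
  refine ⟨⟨fun _ => ?_, fun _ => ?_⟩, ⟨?_, ?_⟩, ?_, ?_⟩
  · exact igusaTodorovDistance_le_of_exact (restriction θ) (restriction_projective θ)
  · exact igusaTodorovDistance_le_of_filtration (fun P _ => fgModuleCat_addObj_of_projective P)
      (inductionFunctor θ) inductionFunctor_projective kernelCounit (restriction θ).obj
      isExtension_kernelCounit hn (isZero_kernelCounit_iterate hn hM)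
  · exact extensionDimension_le_of_exact (restriction θ)
  · exact extensionDimension_le_of_filtration (inflation θ) (actImageFunctor θ).obj
      (actQuotientFunctor θ ⋙ restriction θ).obj
      (fun X => ⟨_, _, _, shortExact_actImage_actQuotient θ X⟩) hn (isZero_actImage_iterate θ hn hM)
  · exact rouquierDimension_le_of_exact (restriction θ) (inflation θ) (inflationCompRestriction θ)
  · exact rouquierDimension_le_of_filtration (inflation θ) (actImageFunctor θ)
      (actQuotientFunctor θ ⋙ restriction θ) (actImageι θ) (actQuotientπ θ)
      (actImageι_comp_actQuotientπ θ) (shortExact_actImage_actQuotient θ) hn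
      (isZero_actImage_iterate θ hn hM)

theorem mainTheorem6 (Γ : Type u) [Ring Γ] [IsNoetherianAlgebra Γ]
    (M : Type u) [AddCommGroup M] [Module Γ M] [Module Γᵐᵒᵖ M] [SMulCommClass Γ Γᵐᵒᵖ M]
    [Module.Finite Γ M] [Module.Finite Γᵐᵒᵖ M]
    (θ : AssocBimoduleHom Γ M)
    (n : ℕ) (hn : 0 < n) (hM : Subsingleton (BimodulePower Γ M n)) :
    (Module.Projective Γ M → Module.Projective Γᵐᵒᵖ M →
      ringIT Γ ≤ ringIT (ThetaExtension θ) ∧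
      ringIT (ThetaExtension θ) ≤ n * (ringIT Γ + 1) - 1) ∧
    (Module.Projective Γᵐᵒᵖ M →
      ringExtDim Γ ≤ ringExtDim (ThetaExtension θ) ∧
      ringExtDim (ThetaExtension θ) ≤ n * (ringExtDim Γ + 1) - 1) ∧
    (IsLeftPerfect Γ M →
      ringDerDim Γ ≤ ringDerDim (ThetaExtension θ) ∧
      ringDerDim (ThetaExtension θ) ≤ n * (ringDerDim Γ + 1) - 1) := by
  obtain ⟨⟨hITlower, hITupper⟩, hext, hder⟩ := mainTheorem6_general Γ M θ n hn hM
  exact ⟨fun hl hr => ⟨hITlower hr, hITupper hl⟩, fun _ => hext, fun _ => hder⟩
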